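/- **Setting.** Let $dx$ denote the uniform probability measure on $\mathbb S^2$. Fix $B>1$ and a normalisation constant $\tau>0$, and let $Y_{\ell,m}$ ($\ell\ge 0$, $|m|\le\ell$) be the standard real spherical harmonics (Legendre and associated Legendre functions in the colatitude, times $\sin(|m|\varphi)$ for $m<0$ or $\cos(m\varphi)$ for $m>0$), normalised to be orthonormal with respect to $\tau\,dx$; thus $\tau=4\pi$ gives the usual formulas with $\frac{2\ell+1}{4\pi}$ and $\frac{2\ell+1}{2\pi}$, and $\tau=1$ gives harmonics orthonormal for $dx$. Let $b\in C^\infty(\mathbb R)$ be supported in $[B^{-1},B]$ with $\sum_{j\ge0}b^2(\ell/B^j)=1$ for all integers $\ell\ge1$. For every $j\ge0$ let $(\xi_{j,k},\lambda_{j,k})_{1\le k\le K_j}$ be points of $\mathbb S^2$ and positive weights with $K_j\simeq B^{2j}$ and $\sum_k\lambda_{j,k}\,p(\xi_{j,k})=\tau\int_{\mathbb S^2} p\,dx$ for all polynomials $p$ of degree at most $2\lfloor B^{j+1}\rfloor$. The needlets are $$\psi_{j,k}(x)=\sqrt{\lambda_{j,k}}\sum_{B^{j-1}\le\ell\le B^{j+1}}b\Big(\frac{\ell}{B^j}\Big)\sum_{m=-\ell}^{\ell}Y_{\ell,m}(\xi_{j,k})Y_{\ell,m}(x),$$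 and for bounded measurable $f$ we write $f_{j,k}=\int_{\mathbb S^2}f\,\psi_{j,k}\,dx$ and $\|\cdot\|_2$ for the norm of $L^2(\mathbb S^2,dx)$. Let $N\ge1$ and $Y_i=g(X_i)+\sigma(X_i)\varepsilon_i$, $i=1,\dots,N$, where the $X_i$ are i.i.d. uniform on $\mathbb S^2$; $g:\mathbb S^2\to\mathbb R$ and $\sigma:\mathbb S^2\to[0,\infty)$ are measurable with $|g|\le G$ and $\sigma\le S$ (for instance $G=\|g\|_\infty$, $S=\|\sigma\|_\infty$); the $\varepsilon_i$ are i.i.d., independent of $(X_i)_i$, with $\mathbb E[\varepsilon_i]=0$, $\mathbb E[\varepsilon_i^2]=1$, $\mathbb E[\varepsilon_i^3]=\gamma_3$ and $\mathbb E[\varepsilon_i^4]=\gamma_4<\infty$ (in particular, sub-Gaussian noise is allowed). Put $V=\sigma^2$, $v_{j,k}=V_{j,k}$, $h=g^2+V$ and $$\widehat h_{j,k}=\frac1N\sum_{i=1}^N Y_i^2\,\psi_{j,k}(X_i).$$ **Proposition.** There is a constant $C_{\psi,2}\in(0,\infty)$, depending only on the needlet system, such that $\|\psi_{j,k}\|_2\le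 C_{\psi,2}$ for all $j,k$, and such that for every model as above (every $N$, $g$, $\sigma$, $G$, $S$ and every law of the noise) and all $j\ge 0$, $1\le k\le K_j$, the variable $\widehat h_{j,k}$ is square integrable, $$\mathbb E[\widehat h_{j,k}]=h_{j,k}=v_{j,k}+(g^2)_{j,k},$$ $$\mathrm{Var}(\widehat h_{j,k})\le\frac{C_h}{N},\qquad C_h=\left(S^4\gamma_4+GS^3\gamma_3+G^2S^2+G^4\right)C_{\psi,2}^2 .$$ Moreover, with explicit numerical constants, $$\mathrm{Var}(\widehat h_{j,k})\le\frac{\left(S^4\gamma_4+4GS^3|\gamma_3|+6G^2S^2+G^4\right)\|\psi_{j,k}\|_2^2}{N}.$$ -/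

import Mathlib

open MeasureTheory ProbabilityTheory Polynomial
open scoped ContDiff

noncomputable section

namespace SphNeedlet

/-- The unit sphere of three-dimensional Euclidean space. -/
abbrev S2 : Type := Metric.sphere (0 : EuclideanSpace ℝ (Fin 3)) 1

/-- The uniform probability measure on the sphere: normalised surface measure. -/
def unif : Measure S2 :=
  ((volume : Measure (EuclideanSpace ℝ (Fin 3))).toSphere Set.univ)⁻¹ •
    (volume : Measure (EuclideanSpace ℝ (Fin 3))).toSphere

/-- Cosine of the colatitude of `x` (its third coordinate). -/
def cosColat (x : S2) : ℝ := (x : EuclideanSpace ℝ (Fin 3)) 2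

/-- Longitude of `x`, the polar angle of its first two coordinates. -/
def longitude (x : S2) : ℝ :=
  Complex.arg ⟨(x : EuclideanSpace ℝ (Fin 3)) 0, (x : EuclideanSpace ℝ (Fin 3)) 1⟩

/-- The Legendre polynomial of degree `l`, by Rodrigues' formula. -/
def legendre (l : ℕ) : ℝ[X] :=
  C (1 / ((2 : ℝ) ^ l * (l.factorial : ℝ))) * derivative^[l] ((X ^ 2 - 1) ^ l)

/-- The associated Legendre function of degree `l` and order `m`. (The sign `(-1) ^ m` used by
some authors cancels in the needlets.) -/
def assocLegendre (l m : ℕ) (t : ℝ) : ℝ :=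
  √(1 - t ^ 2) ^ m * (derivative^[m] (legendre l)).eval t

/-- Real spherical harmonics, orthonormal in `L²` of the rotation invariant measure of total mass
`τ`. The choice `τ = 4π` gives the usual formulas for the surface measure
(`(2l+1)/(4π)` for `m = 0` and `(2l+1)/(2π)` for `m ≠ 0`), the choice `τ = 1` those for the
uniform probability measure. -/
def sphHarm (τ : ℝ) (l : ℕ) (m : ℤ) (x : S2) : ℝ :=
  if m < 0 then
    √(2 * (2 * l + 1) / τ * ((l - m.natAbs).factorial / (l + m.natAbs).factorial)) *
      assocLegendre l m.natAbs (cosColat x) * Real.sin (m.natAbs * longitude x)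
  else if m = 0 then
    √((2 * l + 1) / τ) * (legendre l).eval (cosColat x)
  else
    √(2 * (2 * l + 1) / τ * ((l - m.natAbs).factorial / (l + m.natAbs).factorial)) *
      assocLegendre l m.natAbs (cosColat x) * Real.cos (m.natAbs * longitude x)

/-- Needlet window functions for the scaling parameter `B`. -/
structure IsWindow (B : ℝ) (b : ℝ → ℝ) : Prop where
  smooth : ContDiff ℝ ∞ b
  support_subset : Function.support b ⊆ Set.Icc B⁻¹ B
  partition_of_unity : ∀ l : ℕ, 1 ≤ l → HasSum (fun j : ℕ => b (l / B ^ j) ^ 2) 1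

/-- Cubature points and positive weights at every scale `j`, exact for the restrictions to the
sphere of all polynomials of degree at most `2⌊B^(j+1)⌋` (with respect to the rotation invariant
measure of total mass `τ`), with a number of points of order `B^(2j)`. -/
structure Cubature (τ B : ℝ) where
  K : ℕ → ℕ
  pt : (j : ℕ) → Fin (K j) → S2
  wt : (j : ℕ) → Fin (K j) → ℝ
  wt_pos : ∀ j k, 0 < wt j k
  exact : ∀ (j : ℕ) (p : MvPolynomial (Fin 3) ℝ), p.totalDegree ≤ 2 * ⌊B ^ (j + 1)⌋₊ →
    ∑ k, wt j k * p.eval (fun i => (pt j k : EuclideanSpace ℝ (Fin 3)) i) =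
      τ * ∫ x : S2, p.eval (fun i => (x : EuclideanSpace ℝ (Fin 3)) i) ∂unif
  card_equiv : ∃ c₁ c₂ : ℝ, 0 < c₁ ∧ 0 < c₂ ∧
    ∀ j, c₁ * B ^ (2 * j) ≤ (K j : ℝ) ∧ (K j : ℝ) ≤ c₂ * B ^ (2 * j)

/-- The needlet `ψ_{j,k}`; `l` runs over the integers with `B^(j-1) ≤ l ≤ B^(j+1)`. -/
def needlet {τ B : ℝ} (b : ℝ → ℝ) (Q : Cubature τ B) (j : ℕ) (k : Fin (Q.K j)) (x : S2) : ℝ :=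
  √(Q.wt j k) * ∑ l ∈ Finset.Icc ⌈B ^ ((j : ℤ) - 1)⌉₊ ⌊B ^ (j + 1)⌋₊,
    b (l / B ^ j) * ∑ m ∈ Finset.Icc (-(l : ℤ)) l, sphHarm τ l m (Q.pt j k) * sphHarm τ l m x

/-- The needlet coefficient `f_{j,k} = ∫ f ψ_{j,k} dx`, where `dx` is the uniform probability
measure. -/
def coeff {τ B : ℝ} (b : ℝ → ℝ) (Q : Cubature τ B) (f : S2 → ℝ) (j : ℕ) (k : Fin (Q.K j)) : ℝ :=
  ∫ x, f x * needlet b Q j k x ∂unif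

/-- The `L²` norm of `ψ_{j,k}` with respect to the uniform probability measure. -/
def needletNorm {τ B : ℝ} (b : ℝ → ℝ) (Q : Cubature τ B) (j : ℕ) (k : Fin (Q.K j)) : ℝ :=
  (eLpNorm (needlet b Q j k) 2 unif).toReal

/-- The assumptions on design, noise, mean function `g` and scale function `σ` in the
heteroskedastic model `Y_i = g(X_i) + σ(X_i) ε_i`. Here `G` and `S` bound `|g|` and `σ`, and `γ₃`,
`γ₄` are the third and fourth moments of the noise. -/
structure IsModel {Ω : Type*} [MeasurableSpace Ω] (P : Measure Ω) {N : ℕ}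
    (g σ : S2 → ℝ) (G S γ₃ γ₄ : ℝ) (X : Fin N → Ω → S2) (ε : Fin N → Ω → ℝ) : Prop where
  measurable_g : Measurable g
  measurable_scale : Measurable σ
  abs_g_le : ∀ x, |g x| ≤ G
  scale_nonneg : ∀ x, 0 ≤ σ x
  scale_le : ∀ x, σ x ≤ S
  law_design : ∀ i, HasLaw (X i) unif P
  indep_design : iIndepFun X P
  identDistrib_noise : ∀ i i', IdentDistrib (ε i) (ε i') P P
  indep_noise : iIndepFun ε P
  indep_design_noise : IndepFun (fun w i => X i w) (fun w i => ε i w) P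
  memLp_noise : ∀ i, MemLp (ε i) 4 P
  mean_noise : ∀ i, ∫ w, ε i w ∂P = 0
  variance_noise : ∀ i, ∫ w, ε i w ^ 2 ∂P = 1
  third_moment_noise : ∀ i, ∫ w, ε i w ^ 3 ∂P = γ₃
  fourth_moment_noise : ∀ i, ∫ w, ε i w ^ 4 ∂P = γ₄

/-- The observation `Y_i = g(X_i) + σ(X_i) ε_i`. -/
def obs {Ω : Type*} {N : ℕ} (g σ : S2 → ℝ) (X : Fin N → Ω → S2) (ε : Fin N → Ω → ℝ)
    (i : Fin N) (w : Ω) : ℝ :=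
  g (X i w) + σ (X i w) * ε i w

/-- The empirical coefficient `N⁻¹ ∑ Y_i² ψ_{j,k}(X_i)`. -/
def empCoeff {Ω : Type*} {N : ℕ} {τ B : ℝ} (b : ℝ → ℝ) (Q : Cubature τ B) (X : Fin N → Ω → S2)
    (Y : Fin N → Ω → ℝ) (j : ℕ) (k : Fin (Q.K j)) (w : Ω) : ℝ :=
  (N : ℝ)⁻¹ * ∑ i, Y i w ^ 2 * needlet b Q j k (X i w)

end SphNeedlet

end

/-!
The two variance bounds come from the variance of an i.i.d. mean and from a bound on the `L²` norms
of the needlets that is uniform in the scale and the position.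

*Variance.* The summands `Y_i² ψ(X_i)` are pairwise independent, so the variance of their mean is
at most `1 / N` times a second moment. As the noise is independent of the design,
`E[Y⁴ ψ(X)²] = ∫ (g⁴ + 6 g² σ² + 4 γ₃ g σ³ + γ₄ σ⁴) ψ² dx`, which gives the bound with explicit
constants (`IsModel.variance_empCoeff_le`). The form without the constants `4` and `6`, and with
the sign of `γ₃`, follows from `γ₃² ≤ γ₄` at the cost of a factor `16` (`moment_bound_le`), which is
absorbed into the square of the constant `4 / √τ`.

*Needlet norms.* Let `Z_l(ξ, x) = ∑ Y_{l,m}(ξ) Y_{l,m}(x)`. By orthonormality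
`τ ‖ψ_{j,k}‖² = λ A` with `A = ∑ b² Z_l(ξ, ξ)`, where `ξ` and `λ` are the cubature point and its
weight. The cubature formula is exact for the square of the polynomial `∑ b² Z_l(ξ, ·)`; its term
at `ξ` is `λ A²`, and the integral is `∑ b⁴ Z_l(ξ, ξ) ≤ A` since `b² ≤ 1`. Hence `λ A ≤ 1`
(`wt_mul_zonalKernel_le_one`). Neither the addition theorem nor a separate estimate of the weights
is needed.

*Orthonormality of the spherical harmonics.* In terms of the third coordinate `z` and
`w = x₀ + i x₁`, the harmonic of order `m` is, up to its constant, `P_l^{(|m|)}(z)` times the real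
or imaginary part of `w ^ |m|`. Rotations about the third axis make different angular parts
orthogonal (`integral_planar_pow_mul_conj_pow_of_ne`). What is left are the means of polynomials in
`z`, which is uniform on `[-1, 1]` by Archimedes' theorem (`zonalMean_derivative`, obtained from the
moments of `z` through Gaussian integrals). The integrals `∫ (1 - t²)^m P_l^{(m)} P_{l'}^{(m)}`
satisfy a recurrence in `m` by the Legendre equation (`functional_legendre_succ`), which yields
both orthogonality and the norms.
-/

noncomputable section

namespace SphNeedlet

/-! ### Legendre polynomials -/

/-- The equation `(X² - 1) u' = 2 l X u` for `u = (X² - 1) ^ l`, differentiated `k + 1` times. -/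
theorem iterate_derivative_sq_sub_one_pow_ode (l k : ℕ) :
    (X ^ 2 - 1 : ℝ[X]) * derivative^[k + 2] ((X ^ 2 - 1) ^ l) +
      2 * ((k : ℝ[X]) + 1 - (l : ℝ[X])) * X * derivative^[k + 1] ((X ^ 2 - 1) ^ l) +
      ((k : ℝ[X]) + 1) * ((k : ℝ[X]) - 2 * (l : ℝ[X])) * derivative^[k] ((X ^ 2 - 1) ^ l) = 0 := by
  induction k with
  | zero =>
    have h : (X ^ 2 - 1 : ℝ[X]) * derivative ((X ^ 2 - 1) ^ l) =
        2 * (l : ℝ[X]) * X * (X ^ 2 - 1) ^ l := by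
      cases l with
      | zero => simp
      | succ l =>
        simp only [derivative_pow, derivative_sub, derivative_X, derivative_one, map_natCast]
        simp
        ring
    have h2 := congrArg derivative h
    simp only [derivative_mul, derivative_sub, derivative_X_pow, derivative_one, derivative_X,
      derivative_natCast, derivative_ofNat] at h2
    simp only [Function.iterate_succ, Function.iterate_zero, Function.comp, id]
    simp [map_ofNat] at h2 ⊢
    linear_combination h2
  | succ k ih =>
    have h2 := congrArg derivative ih
    simp only [derivative_mul, derivative_add, derivative_sub, derivative_X_pow, derivative_one,
      derivative_X, derivative_natCast, derivative_ofNat,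
      ← Function.iterate_succ_apply' derivative] at h2
    simp [map_ofNat] at h2 ⊢
    linear_combination h2

/-- The Legendre differential equation, differentiated `m` times. -/
theorem legendre_ode (l m : ℕ) :
    (1 - X ^ 2 : ℝ[X]) * derivative^[m + 2] (legendre l) -
      2 * ((m : ℝ[X]) + 1) * X * derivative^[m + 1] (legendre l) =
      -(((l : ℝ[X]) - (m : ℝ[X])) * ((l : ℝ[X]) + (m : ℝ[X]) + 1)) *
        derivative^[m] (legendre l) := by
  have h := iterate_derivative_sq_sub_one_pow_ode l (m + l)
  simp only [legendre, iterate_derivative_C_mul, ← Function.iterate_add_apply]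
  rw [show m + 2 + l = m + l + 2 by ring, show m + 1 + l = m + l + 1 by ring]
  push_cast at h
  linear_combination (- C (1 / ((2 : ℝ) ^ l * (l.factorial : ℝ)))) * h

theorem natDegree_legendre_le (l : ℕ) : (legendre l).natDegree ≤ l := by
  refine (natDegree_C_mul_le _ _).trans ((natDegree_iterate_derivative _ _).trans ?_)
  have : ((X ^ 2 - 1 : ℝ[X]) ^ l).natDegree ≤ l * 2 :=
    natDegree_pow_le_of_le l (by compute_degree)
  omega

theorem iterate_derivative_legendre_self (l : ℕ) :
    derivative^[l] (legendre l) =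
      C (((2 * l).factorial : ℝ) / (2 ^ l * (l.factorial : ℝ))) := by
  have hm : ((X : ℝ[X]) ^ 2 - 1).Monic := by monicity!
  have hd : ((X : ℝ[X]) ^ 2 - 1).natDegree = 2 := by compute_degree!
  have hd2 : ((X ^ 2 - 1 : ℝ[X]) ^ l).natDegree = 2 * l := by
    rw [hm.natDegree_pow, hd, mul_comm]
  have h : derivative^[2 * l] ((X ^ 2 - 1 : ℝ[X]) ^ l) = C ((2 * l).factorial : ℝ) := by
    rw [eq_C_of_natDegree_le_zero
      ((natDegree_iterate_derivative ((X ^ 2 - 1 : ℝ[X]) ^ l) (2 * l)).trans (by omega)),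
      coeff_iterate_derivative, zero_add, Nat.descFactorial_self]
    have : ((X ^ 2 - 1 : ℝ[X]) ^ l).coeff (2 * l) = 1 := by
      rw [← hd2]; exact (hm.pow l).coeff_natDegree
    rw [this]; simp
  rw [legendre, iterate_derivative_C_mul, ← Function.iterate_add_apply, ← two_mul, h, ← C_mul]
  congr 1
  ring

section Functional

variable {L : ℝ[X] →ₗ[ℝ] ℝ} (hL : ∀ p, L (derivative p) = (p.eval 1 - p.eval (-1)) / 2)
include hL

/-- Integration by parts with the Legendre equation, for a functional `L` that acts on polynomials
as the mean over `[-1, 1]`; the boundary terms vanish because of the factor `1 - X²`. -/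
theorem functional_legendre_succ (l l' m : ℕ) :
    L ((1 - X ^ 2) ^ (m + 1) * derivative^[m + 1] (legendre l) *
        derivative^[m + 1] (legendre l')) =
      ((l - m) * (l + m + 1) : ℝ) *
        L ((1 - X ^ 2) ^ m * derivative^[m] (legendre l) * derivative^[m] (legendre l')) := by
  have h := hL ((1 - X ^ 2) ^ (m + 1) * derivative^[m + 1] (legendre l) *
    derivative^[m] (legendre l'))
  have h0 : ((((1 - X ^ 2) ^ (m + 1) * derivative^[m + 1] (legendre l) *
    derivative^[m] (legendre l')).eval 1 -
    ((1 - X ^ 2) ^ (m + 1) * derivative^[m + 1] (legendre l) *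
      derivative^[m] (legendre l')).eval (-1)) / 2 : ℝ) = 0 := by simp
  rw [h0] at h
  have h1 : derivative ((1 - X ^ 2) ^ (m + 1) * derivative^[m + 1] (legendre l) *
      derivative^[m] (legendre l')) =
      (1 - X ^ 2) ^ (m + 1) * derivative^[m + 1] (legendre l) *
        derivative^[m + 1] (legendre l') -
      ((l - m) * (l + m + 1) : ℝ) •
        ((1 - X ^ 2) ^ m * derivative^[m] (legendre l) * derivative^[m] (legendre l')) := by
    have h2 := legendre_ode l m
    rw [derivative_mul, derivative_mul, derivative_pow, ← Function.iterate_succ_apply' derivative,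
      ← Function.iterate_succ_apply' derivative, smul_eq_C_mul]
    simp [-Function.iterate_succ]
    linear_combination ((1 - X ^ 2) ^ m * derivative^[m] (legendre l')) * h2
  rw [h1, map_sub, map_smul, smul_eq_mul] at h
  linarith

/-- The recurrence in the order has the factor `l (l + 1) - m (m + 1)`, while its left side is
symmetric in `l` and `l'`. -/
theorem functional_legendre_of_ne {l l' : ℕ} (hll : l ≠ l') (m : ℕ) :
    L ((1 - X ^ 2) ^ m * derivative^[m] (legendre l) * derivative^[m] (legendre l')) = 0 := by
  have h1 := functional_legendre_succ hL l l' m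
  have h2 := functional_legendre_succ hL l' l m
  rw [mul_right_comm, h1, mul_right_comm _ (derivative^[m] (legendre l'))] at h2
  have h3 : ((l - l') * (l + l' + 1) : ℝ) ≠ 0 := by
    refine mul_ne_zero (sub_ne_zero.2 (by exact_mod_cast hll)) (by positivity)
  refine (mul_eq_zero.1 (?_ : ((l - l') * (l + l' + 1) : ℝ) * _ = 0)).resolve_left h3
  linear_combination h2

/-- Wallis' recurrence, from the derivative of `X (1 - X²) ^ (l + 1)`. -/
theorem functional_one_sub_sq_pow (l : ℕ) :
    L ((1 - X ^ 2) ^ l) = 4 ^ l * (l.factorial : ℝ) ^ 2 / ((2 * l + 1).factorial : ℝ) := by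
  induction l with
  | zero =>
    have := hL X
    simp at this ⊢
    linarith
  | succ l ih =>
    have h := hL (X * (1 - X ^ 2) ^ (l + 1))
    have h1 : derivative (X * (1 - X ^ 2 : ℝ[X]) ^ (l + 1)) =
        (2 * l + 3 : ℝ) • (1 - X ^ 2) ^ (l + 1) - (2 * (l + 1) : ℝ) • (1 - X ^ 2) ^ l := by
      rw [derivative_mul, derivative_pow, smul_eq_C_mul, smul_eq_C_mul]
      simp [map_ofNat]
      ring
    rw [h1, map_sub, map_smul, map_smul, ih] at h
    simp at h
    have h3 : ((2 * (l + 1) + 1).factorial : ℝ) =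
        (2 * l + 3) * (2 * l + 2) * ((2 * l + 1).factorial : ℝ) := by
      rw [show 2 * (l + 1) + 1 = 2 * l + 1 + 1 + 1 by ring, Nat.factorial_succ,
        Nat.factorial_succ (2 * l + 1)]
      push_cast
      ring
    have h4 : (((l + 1).factorial : ℕ) : ℝ) = (l + 1) * (l.factorial : ℝ) := by
      rw [Nat.factorial_succ]; push_cast; ring
    have h5 : ((2 * l + 1).factorial : ℝ) ≠ 0 := by positivity
    rw [h3, h4]
    field_simp at h ⊢
    linear_combination 2 * h

/-- The recurrence links the order `m` to the order `l`, where the derivative of the Legendre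
polynomial is constant. -/
theorem functional_legendre_self {l m : ℕ} (hm : m ≤ l) :
    L ((1 - X ^ 2) ^ m * derivative^[m] (legendre l) * derivative^[m] (legendre l)) =
      (2 * l + 1 : ℝ)⁻¹ * (((l + m).factorial : ℝ) / ((l - m).factorial : ℝ)) := by
  set J : ℕ → ℝ := fun m =>
    L ((1 - X ^ 2) ^ m * derivative^[m] (legendre l) * derivative^[m] (legendre l)) with hJ
  have key' : ∀ m ≤ l, J m * ((l - m).factorial : ℝ) =
      J 0 * ((l + m).factorial : ℝ) := by
    intro m hm
    induction m with
    | zero => simp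
    | succ m ih =>
      have h1 : J (m + 1) = ((l - m) * (l + m + 1) : ℝ) * J m := functional_legendre_succ hL l l m
      have h2 := ih (by omega)
      obtain ⟨d, rfl⟩ : ∃ d, l = m + 1 + d := ⟨l - (m + 1), by omega⟩
      rw [show m + 1 + d - m = d + 1 by omega, Nat.factorial_succ] at h2
      rw [show m + 1 + d - (m + 1) = d by omega, h1,
        show m + 1 + d + (m + 1) = m + 1 + d + m + 1 by ring,
        Nat.factorial_succ (m + 1 + d + m)]
      push_cast at h2 ⊢
      linear_combination (m + 1 + d + m + 1 : ℝ) * h2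
  have hJl : J l = (((2 * l).factorial : ℝ) / (2 ^ l * (l.factorial : ℝ))) ^ 2 *
      (4 ^ l * (l.factorial : ℝ) ^ 2 / ((2 * l + 1).factorial : ℝ)) := by
    simp only [hJ]
    rw [iterate_derivative_legendre_self, mul_assoc, ← C_mul, mul_comm, ← smul_eq_C_mul, map_smul,
      functional_one_sub_sq_pow hL, smul_eq_mul, ← sq]
  have hJ0 : J 0 = (2 * l + 1 : ℝ)⁻¹ := by
    have h := key' l le_rfl
    rw [hJl, ← two_mul, Nat.factorial_succ] at h
    have h2 : ((2 * l).factorial : ℝ) ≠ 0 := by positivity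
    have h4 : (4 : ℝ) ^ l = (2 ^ l) ^ 2 := by rw [← pow_mul, mul_comm, pow_mul]; norm_num
    rw [h4] at h
    push_cast at h
    simp at h
    field_simp at h ⊢
    linear_combination -h
  have h := key' m hm
  have h2 : ((l - m).factorial : ℝ) ≠ 0 := by positivity
  change J m = _
  rw [← hJ0]
  field_simp
  linear_combination h

end Functional

/-! ### The uniform measure on the sphere -/

instance isProbabilityMeasure_unif : IsProbabilityMeasure unif := by
  constructor
  rw [unif, Measure.smul_apply, smul_eq_mul]
  refine ENNReal.inv_mul_cancel ?_ (measure_ne_top _ _)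
  rw [ne_eq, Measure.measure_univ_eq_zero]
  exact Measure.toSphere_ne_zero _

/-- The restriction of a linear isometry to the sphere. -/
def sphereMap (R : EuclideanSpace ℝ (Fin 3) ≃ₗᵢ[ℝ] EuclideanSpace ℝ (Fin 3)) (x : S2) : S2 :=
  ⟨R x, by simp⟩

theorem continuous_sphereMap (R : EuclideanSpace ℝ (Fin 3) ≃ₗᵢ[ℝ] EuclideanSpace ℝ (Fin 3)) :
    Continuous (sphereMap R) := by
  unfold sphereMap
  fun_prop

open scoped Pointwise in
theorem measurePreserving_sphereMap
    (R : EuclideanSpace ℝ (Fin 3) ≃ₗᵢ[ℝ] EuclideanSpace ℝ (Fin 3)) :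
    MeasurePreserving (sphereMap R) unif unif := by
  refine ⟨(continuous_sphereMap R).measurable, ?_⟩
  have hm := (continuous_sphereMap R).measurable
  ext s hs
  rw [Measure.map_apply hm hs, unif, Measure.smul_apply, Measure.smul_apply,
    Measure.toSphere_apply' _ hs, Measure.toSphere_apply' _ (hm hs)]
  congr 2
  rw [← (R.symm.measurePreserving).measure_preimage_equiv (f := R.symm.toMeasurableEquiv)]
  congr 1
  ext y
  simp only [Set.mem_smul, Set.mem_image, Set.mem_preimage]
  constructor
  · rintro ⟨r, hr, _, ⟨x, hx, rfl⟩, h⟩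
    refine ⟨r, hr, _, ⟨_, hx, rfl⟩, ?_⟩
    change r • R x = y
    rw [← map_smul, h]
    exact R.apply_symm_apply y
  · rintro ⟨r, hr, _, ⟨x, hx, rfl⟩, rfl⟩
    refine ⟨r, hr, R.symm x, ⟨sphereMap R.symm x, ?_, rfl⟩, (map_smul R.symm r _).symm⟩
    have : sphereMap R (sphereMap R.symm x) = x := by ext1; simp [sphereMap]
    rwa [this]

theorem integral_sphereMap (R : EuclideanSpace ℝ (Fin 3) ≃ₗᵢ[ℝ] EuclideanSpace ℝ (Fin 3))
    {f : S2 → ℝ} (hf : Continuous f) : ∫ x, f (sphereMap R x) ∂unif = ∫ x, f x ∂unif := by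
  rw [← integral_map (f := f) (measurePreserving_sphereMap R).measurable.aemeasurable
    hf.aestronglyMeasurable, (measurePreserving_sphereMap R).map_eq]

theorem integrable_unif {f : S2 → ℝ} (hf : Continuous f) : Integrable f unif := by
  have : CompactSpace S2 := Metric.sphere.compactSpace _ _
  exact hf.integrable_of_hasCompactSupport (HasCompactSupport.of_compactSpace f)

/-- Gaussian integrals of homogeneous functions in polar coordinates. -/
theorem integral_homogeneous_mul_exp {f : EuclideanSpace ℝ (Fin 3) → ℝ} {n : ℕ}
    (hf : ∀ (r : ℝ) (x), 0 < r → f (r • x) = r ^ n * f x) :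
    ∫ x, f x * Real.exp (-‖x‖ ^ 2) =
      (∫ x : S2, f x ∂(volume : Measure (EuclideanSpace ℝ (Fin 3))).toSphere) *
        ∫ r in Set.Ioi (0 : ℝ), r ^ (n + 2) * Real.exp (-r ^ 2) := by
  set μ : Measure (EuclideanSpace ℝ (Fin 3)) := volume
  calc ∫ x, f x * Real.exp (-‖x‖ ^ 2) ∂μ
      = ∫ x : ({(0)}ᶜ : Set (EuclideanSpace ℝ (Fin 3))), f x * Real.exp (-‖x.1‖ ^ 2)
          ∂(μ.comap (↑)) := by
        rw [integral_subtype_comap (measurableSet_singleton _).compl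
          fun x ↦ f x * Real.exp (-‖x‖ ^ 2), restrict_compl_singleton]
    _ = ∫ x, f x.1 * (x.2.1 ^ n * Real.exp (- x.2.1 ^ 2))
          ∂μ.toSphere.prod (.volumeIoiPow 2) := by
        have h := μ.measurePreserving_homeomorphUnitSphereProd.integral_comp
          (Homeomorph.measurableEmbedding _)
          (fun x => f x.1 * (x.2.1 ^ n * Real.exp (- x.2.1 ^ 2)))
        simp only [finrank_euclideanSpace, Fintype.card_fin, Nat.add_one_sub_one] at h
        rw [← h]
        refine integral_congr_ae (.of_forall fun x => ?_)
        have hx : 0 < ‖(x : EuclideanSpace ℝ (Fin 3))‖ := norm_pos_iff.2 x.2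
        have h1 : f ((homeomorphUnitSphereProd _ x).1 : EuclideanSpace ℝ (Fin 3)) =
            ‖(x : EuclideanSpace ℝ (Fin 3))‖⁻¹ ^ n * f x := by
          rw [← hf _ _ (inv_pos.2 hx)]; simp
        simp only [homeomorphUnitSphereProd_apply_snd_coe, h1]
        have h2 : ‖(x : EuclideanSpace ℝ (Fin 3))‖⁻¹ ^ n * ‖(x : EuclideanSpace ℝ (Fin 3))‖ ^ n =
          1 := by
          rw [← mul_pow, inv_mul_cancel₀ hx.ne', one_pow]
        linear_combination (- f x * Real.exp (-‖(x : EuclideanSpace ℝ (Fin 3))‖ ^ 2)) * h2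
    _ = (∫ x : S2, f x ∂μ.toSphere) * ∫ r : Set.Ioi (0 : ℝ), r.1 ^ n * Real.exp (- r.1 ^ 2)
          ∂(.volumeIoiPow 2) :=
        integral_prod_mul (fun x : S2 => f x)
          (fun r : Set.Ioi (0 : ℝ) => r.1 ^ n * Real.exp (- r.1 ^ 2))
    _ = _ := by
      congr 1
      simp only [Measure.volumeIoiPow, ENNReal.ofReal]
      rw [integral_withDensity_eq_integral_smul,
        integral_subtype_comap measurableSet_Ioi fun a : ℝ ↦
          Real.toNNReal (a ^ 2) • (a ^ n * Real.exp (- a ^ 2)),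
        setIntegral_congr_fun measurableSet_Ioi fun x hx ↦ ?_]
      · rw [NNReal.smul_def, Real.coe_toNNReal _ (sq_nonneg _), smul_eq_mul]; ring
      · exact (measurable_subtype_coe.pow_const _).real_toNNReal

theorem integral_Ioi_pow_mul_exp_neg_sq (n : ℕ) :
    ∫ r in Set.Ioi (0 : ℝ), r ^ n * Real.exp (-r ^ 2) = 1 / 2 * Real.Gamma ((n + 1) / 2) := by
  have h := integral_rpow_mul_exp_neg_rpow (p := 2) (q := n) (by norm_num)
    (by have : (0 : ℝ) ≤ n := by positivity
        linarith)
  rw [← h]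
  refine setIntegral_congr_fun measurableSet_Ioi fun x hx ↦ ?_
  simp

theorem integral_even_pow_mul_exp_neg_sq (k : ℕ) :
    ∫ r : ℝ, r ^ (2 * k) * Real.exp (-r ^ 2) = Real.Gamma (k + 1 / 2) := by
  have h := integral_comp_abs (f := fun r : ℝ => r ^ (2 * k) * Real.exp (-r ^ 2))
  simp only [pow_mul, sq_abs] at h
  rw [show (k : ℝ) + 1 / 2 = ((2 * k : ℕ) + 1) / 2 by push_cast; ring]
  have h2 := integral_Ioi_pow_mul_exp_neg_sq (2 * k)
  simp only [pow_mul] at h2 ⊢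
  rw [h, h2]; ring

/-- The Gaussian integral of an even power of the third coordinate, in Cartesian coordinates. -/
theorem integral_coord_pow_mul_exp (k : ℕ) :
    ∫ x : EuclideanSpace ℝ (Fin 3), x 2 ^ (2 * k) * Real.exp (-‖x‖ ^ 2) =
      Real.Gamma (1 / 2) ^ 2 * Real.Gamma (k + 1 / 2) := by
  rw [← (PiLp.volume_preserving_toLp (Fin 3)).integral_comp
    (MeasurableEquiv.toLp 2 _).measurableEmbedding]
  have h := integral_fintype_prod_volume_eq_prod (ι := Fin 3) (𝕜 := ℝ) (E := fun _ => ℝ)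
    (fun i r => r ^ (2 * (if i = 2 then k else 0)) * Real.exp (-r ^ 2))
  simp only [integral_even_pow_mul_exp_neg_sq, Fin.prod_univ_three] at h
  simp at h
  rw [sq]
  simp only [one_div]
  rw [← h]
  congr 1
  ext x
  simp [EuclideanSpace.norm_sq_eq, Fin.sum_univ_three, Real.exp_add]
  ring

theorem integral_unif (f : S2 → ℝ) : ∫ x, f x ∂unif =
    (∫ x, f x ∂(volume : Measure (EuclideanSpace ℝ (Fin 3))).toSphere) /
      ∫ _, (1 : ℝ) ∂(volume : Measure (EuclideanSpace ℝ (Fin 3))).toSphere := by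
  rw [unif, integral_smul_measure, integral_const, smul_eq_mul, smul_eq_mul, mul_one,
    ENNReal.toReal_inv, Measure.real, div_eq_inv_mul]

theorem continuous_cosColat : Continuous cosColat := by
  unfold cosColat
  fun_prop

/-- The polar and the Cartesian form of the same Gaussian integral determine the unnormalised
moment; the exponent zero gives the total mass. -/
theorem integral_cosColat_pow_even (k : ℕ) :
    ∫ x, cosColat x ^ (2 * k) ∂unif = (2 * k + 1 : ℝ)⁻¹ := by
  have h1 := integral_homogeneous_mul_exp (f := fun x => x 2 ^ (2 * k)) (n := 2 * k)
    (fun r x _ => by simp [mul_pow])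
  have h2 := integral_homogeneous_mul_exp (f := fun x => x 2 ^ (2 * 0)) (n := 2 * 0)
    (fun r x _ => by simp)
  rw [integral_coord_pow_mul_exp, integral_Ioi_pow_mul_exp_neg_sq] at h1 h2
  rw [show (((2 * k + 2 : ℕ) : ℝ) + 1) / 2 = (k + 1 / 2) + 1 by push_cast; ring,
    Real.Gamma_add_one (by positivity)] at h1
  rw [show (((2 * 0 + 2 : ℕ) : ℝ) + 1) / 2 = 1 / 2 + 1 by norm_num,
    Real.Gamma_add_one (by positivity)] at h2
  have hk : 0 < Real.Gamma (k + 1 / 2) := Real.Gamma_pos_of_pos (by positivity)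
  have h0 : 0 < Real.Gamma (1 / 2) := Real.Gamma_pos_of_pos (by positivity)
  simp only [mul_zero, pow_zero, Nat.cast_zero, zero_add] at h2
  rw [integral_unif]
  unfold cosColat
  set A := ∫ x : S2, (x : EuclideanSpace ℝ (Fin 3)) 2 ^ (2 * k)
    ∂(volume : Measure (EuclideanSpace ℝ (Fin 3))).toSphere
  set C := ∫ x : S2, (1 : ℝ) ∂(volume : Measure (EuclideanSpace ℝ (Fin 3))).toSphere
  have h3 : C = 4 * Real.Gamma (1 / 2) ^ 2 := by
    refine mul_right_cancel₀ h0.ne' ?_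
    linear_combination -4 * h2
  have h4 : A * (2 * k + 1) = 4 * Real.Gamma (1 / 2) ^ 2 := by
    refine mul_right_cancel₀ hk.ne' ?_
    linear_combination -4 * h1
  rw [← h3] at h4
  have h5 : C ≠ 0 := by rw [h3]; positivity
  field_simp
  linear_combination h4

theorem integral_cosColat_pow_odd (k : ℕ) : ∫ x, cosColat x ^ (2 * k + 1) ∂unif = 0 := by
  have h := integral_sphereMap (LinearIsometryEquiv.neg ℝ)
    (f := fun x => cosColat x ^ (2 * k + 1)) (continuous_cosColat.pow (2 * k + 1))
  have h1 : ∀ x, cosColat (sphereMap (LinearIsometryEquiv.neg ℝ) x) = - cosColat x := by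
    intro x; simp [cosColat, sphereMap]
  simp only [h1, Odd.neg_pow ⟨k, rfl⟩, integral_neg] at h
  linarith

/-- The mean over the sphere of a polynomial in the third coordinate. -/
def zonalMean : ℝ[X] →ₗ[ℝ] ℝ where
  toFun p := ∫ x, p.eval (cosColat x) ∂unif
  map_add' p q := by
    simp only [eval_add]
    exact integral_add (integrable_unif (p.continuous.comp continuous_cosColat))
      (integrable_unif (q.continuous.comp continuous_cosColat))
  map_smul' c p := by
    simp only [eval_smul, smul_eq_mul, RingHom.id_apply]
    exact integral_const_mul _ _

/-- Archimedes' theorem: the third coordinate is uniformly distributed on `[-1, 1]`. -/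
theorem zonalMean_derivative (p : ℝ[X]) :
    zonalMean (derivative p) = (p.eval 1 - p.eval (-1)) / 2 := by
  induction p using Polynomial.induction_on' with
  | add p q hp hq => rw [derivative_add, map_add, hp, hq, eval_add, eval_add]; ring
  | monomial n a =>
    rw [derivative_monomial]
    change ∫ x, _ ∂unif = _
    simp only [eval_monomial]
    rw [integral_const_mul]
    rcases n with _ | n
    · simp
    obtain ⟨k, rfl | rfl⟩ := n.even_or_odd'
    · rw [Nat.add_sub_cancel, integral_cosColat_pow_even, Odd.neg_one_pow ⟨k, rfl⟩]
      push_cast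
      field_simp
      ring
    · rw [Nat.add_sub_cancel, integral_cosColat_pow_odd,
        Even.neg_one_pow ⟨k + 1, by ring⟩]
      simp

/-! ### Rotations about the third axis -/

/-- The first two coordinates as a complex number. -/
def planar (x : S2) : ℂ := ⟨(x : EuclideanSpace ℝ (Fin 3)) 0, (x : EuclideanSpace ℝ (Fin 3)) 1⟩

theorem continuous_planar : Continuous planar := by
  have : planar = fun x : S2 => (((x : EuclideanSpace ℝ (Fin 3)) 0 : ℝ) : ℂ) +
      (((x : EuclideanSpace ℝ (Fin 3)) 1 : ℝ) : ℂ) * Complex.I := by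
    funext x
    apply Complex.ext <;> simp [planar]
  rw [this]
  fun_prop

theorem normSq_planar (x : S2) : Complex.normSq (planar x) = 1 - cosColat x ^ 2 := by
  have h : ‖(x : EuclideanSpace ℝ (Fin 3))‖ ^ 2 = 1 := by simp
  rw [EuclideanSpace.norm_sq_eq, Fin.sum_univ_three] at h
  simp only [Real.norm_eq_abs, sq_abs] at h
  simp only [Complex.normSq_mk, planar, cosColat]
  linarith

/-- The rotation by the angle `θ` about the third axis. -/
def axialRotation (θ : ℝ) : EuclideanSpace ℝ (Fin 3) ≃ₗᵢ[ℝ] EuclideanSpace ℝ (Fin 3) :=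
  LinearIsometry.toLinearIsometryEquiv
    { toFun := fun x => !₂[Real.cos θ * x 0 - Real.sin θ * x 1,
        Real.sin θ * x 0 + Real.cos θ * x 1, x 2]
      map_add' := fun x y => by
        ext i; fin_cases i <;> simp <;> ring
      map_smul' := fun c x => by
        ext i; fin_cases i <;> simp <;> ring
      norm_map' := fun x => by
        rw [← sq_eq_sq₀ (norm_nonneg _) (norm_nonneg _), EuclideanSpace.norm_sq_eq,
          EuclideanSpace.norm_sq_eq, Fin.sum_univ_three, Fin.sum_univ_three]
        simp
        linear_combination (x 0 ^ 2 + x 1 ^ 2) * Real.sin_sq_add_cos_sq θ } rfl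

theorem cosColat_axialRotation (θ : ℝ) (x : S2) :
    cosColat (sphereMap (axialRotation θ) x) = cosColat x := by
  simp [cosColat, sphereMap, axialRotation]

theorem planar_axialRotation (θ : ℝ) (x : S2) :
    planar (sphereMap (axialRotation θ) x) = Complex.exp (θ * Complex.I) * planar x := by
  rw [Complex.exp_mul_I]
  apply Complex.ext <;>
    simp [planar, sphereMap, axialRotation, Complex.cos_ofReal_re, Complex.sin_ofReal_re]
  ring

/-- Distinct angular frequencies are orthogonal: the rotation by `π / (a - b)` about the third
axis changes the sign of the integrand. The linear map `φ` stands for the real or the imaginary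
part. -/
theorem integral_planar_pow_mul_conj_pow_of_ne {a b : ℕ} (hab : a ≠ b) (p : ℝ[X])
    (φ : ℂ →L[ℝ] ℝ) :
    ∫ x, p.eval (cosColat x) * φ (planar x ^ a * (starRingEnd ℂ) (planar x) ^ b) ∂unif = 0 := by
  have hab' : (a : ℂ) - b ≠ 0 := sub_ne_zero.2 (by exact_mod_cast hab)
  set θ : ℝ := Real.pi / (a - b)
  have hcont : Continuous fun x : S2 =>
      p.eval (cosColat x) * φ (planar x ^ a * (starRingEnd ℂ) (planar x) ^ b) :=
    (p.continuous.comp continuous_cosColat).mul (φ.continuous.comp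
      ((continuous_planar.pow a).mul ((Complex.continuous_conj.comp continuous_planar).pow b)))
  have h := integral_sphereMap (axialRotation θ) hcont
  -- The rotation multiplies the monomial by `exp (i (a - b) θ) = -1`.
  have key : Complex.exp (θ * Complex.I) ^ a *
      (starRingEnd ℂ) (Complex.exp (θ * Complex.I)) ^ b = -1 := by
    rw [← Complex.exp_conj, ← Complex.exp_nat_mul, ← Complex.exp_nat_mul, ← Complex.exp_add,
      ← Complex.exp_pi_mul_I]
    congr 1
    simp only [map_mul, Complex.conj_ofReal, Complex.conj_I, θ]
    push_cast
    field_simp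
    ring
  have h1 : ∀ x : S2, planar (sphereMap (axialRotation θ) x) ^ a *
      (starRingEnd ℂ) (planar (sphereMap (axialRotation θ) x)) ^ b =
      - (planar x ^ a * (starRingEnd ℂ) (planar x) ^ b) := by
    intro x
    rw [planar_axialRotation, map_mul, mul_pow, mul_pow]
    linear_combination (planar x ^ a * (starRingEnd ℂ) (planar x) ^ b) * key
  simp only [h1, cosColat_axialRotation, map_neg, mul_neg, integral_neg] at h
  linarith

/-! ### Spherical harmonics -/

/-- The factor of the real spherical harmonics of order `m` that depends on the longitude, together
with the power of `√(1 - z²)` that makes it a polynomial: the imaginary part of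
`(x₀ + i x₁) ^ |m|` for `m < 0`, its real part for `0 ≤ m`. -/
def angular (m : ℤ) (x : S2) : ℝ :=
  if m < 0 then (planar x ^ m.natAbs).im else (planar x ^ m.natAbs).re

/-- The normalising constant of the spherical harmonic of degree `l` and order `m`. -/
def normConst (τ : ℝ) (l : ℕ) (m : ℤ) : ℝ :=
  if m = 0 then √((2 * l + 1) / τ)
  else √(2 * (2 * l + 1) / τ * ((l - m.natAbs).factorial / (l + m.natAbs).factorial))

theorem planar_pow (x : S2) (n : ℕ) :
    planar x ^ n = ⟨√(1 - cosColat x ^ 2) ^ n * Real.cos (n * longitude x),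
      √(1 - cosColat x ^ 2) ^ n * Real.sin (n * longitude x)⟩ := by
  have h : planar x = ↑(√(1 - cosColat x ^ 2)) * Complex.exp (longitude x * Complex.I) := by
    rw [← normSq_planar, ← Complex.norm_def]
    exact (Complex.norm_mul_exp_arg_mul_I (planar x)).symm
  rw [h, mul_pow, ← Complex.exp_nat_mul, ← mul_assoc, ← Complex.ofReal_natCast,
    ← Complex.ofReal_mul, Complex.exp_mul_I, ← Complex.ofReal_pow]
  apply Complex.ext <;> simp [-Complex.ofReal_mul, Complex.cos_ofReal_re, Complex.sin_ofReal_re,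
    Complex.cos_ofReal_im, Complex.sin_ofReal_im, -Complex.ofReal_pow]

theorem sphHarm_eq (τ : ℝ) (l : ℕ) (m : ℤ) (x : S2) :
    sphHarm τ l m x = normConst τ l m *
      ((derivative^[m.natAbs] (legendre l)).eval (cosColat x) * angular m x) := by
  unfold sphHarm normConst angular assocLegendre
  rw [planar_pow]
  by_cases hm : m < 0
  · simp only [hm, hm.ne, if_true, if_false]
    ring
  · by_cases hm0 : m = 0
    · simp [hm0]
    · simp only [hm, hm0, if_false]
      ring

theorem continuous_angular (m : ℤ) : Continuous (angular m) := by
  unfold angular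
  split_ifs
  · exact Complex.continuous_im.comp (continuous_planar.pow _)
  · exact Complex.continuous_re.comp (continuous_planar.pow _)

theorem continuous_sphHarm (τ : ℝ) (l : ℕ) (m : ℤ) : Continuous (sphHarm τ l m) := by
  have : sphHarm τ l m = fun x => normConst τ l m *
      ((derivative^[m.natAbs] (legendre l)).eval (cosColat x) * angular m x) :=
    funext (sphHarm_eq τ l m)
  rw [this]
  exact continuous_const.mul
    (((Polynomial.continuous _).comp continuous_cosColat).mul (continuous_angular m))

/-- Products of real and imaginary parts of `w ^ a` and `w ^ b` have the form of this integrand,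
by the product formulas for sine and cosine. -/
theorem integral_planar_combination (p : ℝ[X]) (φ : ℂ →L[ℝ] ℝ) (a b : ℕ) (c d : ℝ) :
    ∫ x, p.eval (cosColat x) * (c * φ (planar x ^ (a + b)) +
        d * φ (planar x ^ a * (starRingEnd ℂ) (planar x) ^ b)) ∂unif =
      c * ∫ x, p.eval (cosColat x) * φ (planar x ^ (a + b) * (starRingEnd ℂ) (planar x) ^ 0) ∂unif +
      d * ∫ x, p.eval (cosColat x) * φ (planar x ^ a * (starRingEnd ℂ) (planar x) ^ b) ∂unif := by
  have hc : ∀ a b : ℕ, Integrable (fun x : S2 =>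
      p.eval (cosColat x) * φ (planar x ^ a * (starRingEnd ℂ) (planar x) ^ b)) unif :=
    fun a b => integrable_unif ((p.continuous.comp continuous_cosColat).mul (φ.continuous.comp
      ((continuous_planar.pow a).mul ((Complex.continuous_conj.comp continuous_planar).pow b))))
  rw [← integral_const_mul, ← integral_const_mul,
    ← integral_add ((hc (a + b) 0).const_mul c) ((hc a b).const_mul d)]
  congr 1
  ext x
  rw [pow_zero, mul_one]
  ring

theorem planar_pow_mul_conj_pow (x : S2) (a : ℕ) :
    planar x ^ a * (starRingEnd ℂ) (planar x) ^ a = (((1 - cosColat x ^ 2) ^ a : ℝ) : ℂ) := by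
  rw [← mul_pow, Complex.mul_conj, normSq_planar, Complex.ofReal_pow]

theorem integral_angular_mul_of_ne (p : ℝ[X]) {m m' : ℤ} (h : m ≠ m') :
    ∫ x, p.eval (cosColat x) * (angular m x * angular m' x) ∂unif = 0 := by
  -- For `|m| = |m'|` the signs differ, so that the product is an imaginary part; it vanishes on the
  -- real number `w ^ a * conj w ^ a`.
  obtain ⟨φ, c, d, hφ, hx⟩ : ∃ (φ : ℂ →L[ℝ] ℝ) (c d : ℝ),
      (m.natAbs = m'.natAbs → φ = Complex.imCLM) ∧
      ∀ x, angular m x * angular m' x = c * φ (planar x ^ (m.natAbs + m'.natAbs)) +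
        d * φ (planar x ^ m.natAbs * (starRingEnd ℂ) (planar x) ^ m'.natAbs) := by
    unfold angular
    by_cases h1 : m < 0 <;> by_cases h2 : m' < 0 <;>
      simp only [h1, h2, if_true, if_false, pow_add, ← map_pow]
    · refine ⟨Complex.reCLM, -1 / 2, 1 / 2, fun _ => by omega, fun x => ?_⟩
      simp [-map_pow]
      ring
    · refine ⟨Complex.imCLM, 1 / 2, 1 / 2, fun _ => rfl, fun x => ?_⟩
      simp [-map_pow]
      ring
    · refine ⟨Complex.imCLM, 1 / 2, -1 / 2, fun _ => rfl, fun x => ?_⟩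
      simp [-map_pow]
      ring
    · refine ⟨Complex.reCLM, 1 / 2, 1 / 2, fun _ => by omega, fun x => ?_⟩
      simp [-map_pow]
      ring
  simp only [hx]
  rw [integral_planar_combination, integral_planar_pow_mul_conj_pow_of_ne (by omega), mul_zero,
    zero_add]
  by_cases hab : m.natAbs = m'.natAbs
  · simp only [hφ hab, ← hab, planar_pow_mul_conj_pow, Complex.imCLM_apply, Complex.ofReal_im]
    simp
  · rw [integral_planar_pow_mul_conj_pow_of_ne hab, mul_zero]

theorem integral_angular_sq (p : ℝ[X]) {m : ℤ} (h : m ≠ 0) :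
    ∫ x, p.eval (cosColat x) * (angular m x * angular m x) ∂unif =
      zonalMean ((1 - X ^ 2) ^ m.natAbs * p) / 2 := by
  obtain ⟨c, hx⟩ : ∃ c : ℝ,
      ∀ x, angular m x * angular m x = c * Complex.reCLM (planar x ^ (m.natAbs + m.natAbs)) +
        1 / 2 * Complex.reCLM (planar x ^ m.natAbs * (starRingEnd ℂ) (planar x) ^ m.natAbs) := by
    unfold angular
    by_cases h1 : m < 0 <;> simp only [h1, if_true, if_false, pow_add, ← map_pow]
    · refine ⟨-1 / 2, fun x => ?_⟩
      simp [-map_pow]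
      ring
    · refine ⟨1 / 2, fun x => ?_⟩
      simp [-map_pow]
      ring
  have h1 : ∫ x, p.eval (cosColat x) *
      Complex.reCLM (planar x ^ m.natAbs * (starRingEnd ℂ) (planar x) ^ m.natAbs) ∂unif =
      ∫ x, ((1 - X ^ 2) ^ m.natAbs * p).eval (cosColat x) ∂unif := by
    refine integral_congr_ae (.of_forall fun x => ?_)
    beta_reduce
    rw [planar_pow_mul_conj_pow, Complex.reCLM_apply, Complex.ofReal_re]
    simp
    ring
  simp only [hx]
  rw [integral_planar_combination, integral_planar_pow_mul_conj_pow_of_ne (by omega), h1, mul_zero,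
    zero_add, one_div_mul_eq_div]
  rfl

/-- The spherical harmonics are orthonormal with respect to the rotation invariant measure of
total mass `τ`. -/
theorem sphHarm_orthonormal {τ : ℝ} (hτ : 0 < τ) {l l' : ℕ} {m m' : ℤ} (hm : m.natAbs ≤ l) :
    τ * ∫ x, sphHarm τ l m x * sphHarm τ l' m' x ∂unif = if l = l' ∧ m = m' then 1 else 0 := by
  have h1 : ∫ x, sphHarm τ l m x * sphHarm τ l' m' x ∂unif =
      normConst τ l m * normConst τ l' m' * ∫ x, (derivative^[m.natAbs] (legendre l) *
        derivative^[m'.natAbs] (legendre l')).eval (cosColat x) *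
          (angular m x * angular m' x) ∂unif := by
    rw [← integral_const_mul]
    congr 1
    ext x
    rw [sphHarm_eq, sphHarm_eq, eval_mul]
    ring
  rw [h1]
  by_cases hmm : m = m'
  swap
  · rw [integral_angular_mul_of_ne _ hmm, if_neg (by tauto)]
    ring
  subst hmm
  have h2 : ∫ x, (derivative^[m.natAbs] (legendre l) *
        derivative^[m.natAbs] (legendre l')).eval (cosColat x) *
          (angular m x * angular m x) ∂unif =
      (if m = 0 then 1 else 1 / 2) * zonalMean ((1 - X ^ 2) ^ m.natAbs *
        derivative^[m.natAbs] (legendre l) * derivative^[m.natAbs] (legendre l')) := by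
    split_ifs with h0
    · subst h0
      simp [angular, zonalMean]
    · rw [integral_angular_sq _ h0, ← mul_assoc]
      ring
  rw [h2]
  by_cases hl : l = l'
  swap
  · rw [functional_legendre_of_ne zonalMean_derivative hl]
    simp [hl]
  subst hl
  rw [functional_legendre_self zonalMean_derivative hm]
  simp only [and_self, if_true]
  have hf1 : (((l - m.natAbs).factorial : ℕ) : ℝ) ≠ 0 := by positivity
  have hf2 : (((l + m.natAbs).factorial : ℕ) : ℝ) ≠ 0 := by positivity
  unfold normConst
  split_ifs with h0
  · subst h0
    rw [Real.mul_self_sqrt (by positivity)]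
    simp only [Int.natAbs_zero, Nat.sub_zero, Nat.add_zero]
    field_simp
  · rw [Real.mul_self_sqrt (by positivity)]
    field_simp

/-! ### Spherical harmonics as polynomials -/

theorem exists_mvPolynomial_planar_pow (n : ℕ) :
    ∃ p q : MvPolynomial (Fin 3) ℝ, p.totalDegree ≤ n ∧ q.totalDegree ≤ n ∧
      ∀ x : S2, planar x ^ n = ⟨p.eval (fun i => (x : EuclideanSpace ℝ (Fin 3)) i),
        q.eval (fun i => (x : EuclideanSpace ℝ (Fin 3)) i)⟩ := by
  induction n with
  | zero => exact ⟨1, 0, by simp, by simp, fun x => by apply Complex.ext <;> simp⟩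
  | succ n ih =>
    obtain ⟨p, q, hp, hq, h⟩ := ih
    have hX : ∀ (r : MvPolynomial (Fin 3) ℝ) (i : Fin 3), r.totalDegree ≤ n →
        (r * MvPolynomial.X i).totalDegree ≤ n + 1 := fun r i hr =>
      (MvPolynomial.totalDegree_mul _ _).trans (by rw [MvPolynomial.totalDegree_X]; omega)
    refine ⟨p * MvPolynomial.X 0 - q * MvPolynomial.X 1,
      p * MvPolynomial.X 1 + q * MvPolynomial.X 0,
      (MvPolynomial.totalDegree_sub _ _).trans (max_le (hX _ _ hp) (hX _ _ hq)),
      (MvPolynomial.totalDegree_add _ _).trans (max_le (hX _ _ hp) (hX _ _ hq)), fun x => ?_⟩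
    rw [pow_succ, h]
    apply Complex.ext <;> simp [planar]

theorem totalDegree_aeval_X_le (p : ℝ[X]) (i : Fin 3) :
    (aeval (MvPolynomial.X i : MvPolynomial (Fin 3) ℝ) p).totalDegree ≤ p.natDegree := by
  rw [aeval_eq_sum_range]
  refine MvPolynomial.totalDegree_finsetSum_le fun n hn => ?_
  refine (MvPolynomial.totalDegree_smul_le _ _).trans ?_
  rw [MvPolynomial.totalDegree_X_pow]
  exact Nat.lt_succ_iff.1 (Finset.mem_range.1 hn)

theorem exists_mvPolynomial_sphHarm (τ : ℝ) {l : ℕ} {m : ℤ} (hm : m.natAbs ≤ l) :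
    ∃ p : MvPolynomial (Fin 3) ℝ, p.totalDegree ≤ l ∧
      ∀ x : S2, p.eval (fun i => (x : EuclideanSpace ℝ (Fin 3)) i) = sphHarm τ l m x := by
  obtain ⟨p, q, hp, hq, h⟩ := exists_mvPolynomial_planar_pow m.natAbs
  set r := if m < 0 then q else p with hr
  have hrd : r.totalDegree ≤ m.natAbs := by rw [hr]; split_ifs <;> assumption
  refine ⟨MvPolynomial.C (normConst τ l m) *
    (aeval (MvPolynomial.X 2) (derivative^[m.natAbs] (legendre l)) * r), ?_, fun x => ?_⟩
  · refine (MvPolynomial.totalDegree_mul _ _).trans ?_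
    rw [MvPolynomial.totalDegree_C, zero_add]
    refine (MvPolynomial.totalDegree_mul _ _).trans ?_
    have h1 := totalDegree_aeval_X_le (derivative^[m.natAbs] (legendre l)) 2
    have h2 := natDegree_iterate_derivative (legendre l) m.natAbs
    have h3 := natDegree_legendre_le l
    omega
  · rw [sphHarm_eq, map_mul, map_mul, MvPolynomial.eval_C]
    congr 2
    · rw [Polynomial.aeval_def, Polynomial.hom_eval₂]
      have : (MvPolynomial.eval fun i => (x : EuclideanSpace ℝ (Fin 3)) i).comp
          (algebraMap ℝ (MvPolynomial (Fin 3) ℝ)) = RingHom.id ℝ :=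
        RingHom.ext fun r => MvPolynomial.eval_C r
      rw [this, MvPolynomial.eval_X]
      rfl
    · rw [hr, angular, h]
      split_ifs <;> rfl

/-! ### The uniform bound on the needlets -/

/-- The zonal kernel `∑ a l ∑ Y_{l,m}(ξ) Y_{l,m}(x)` with multipliers `a l`, for `l` in `s`. -/
def zonalKernel (τ : ℝ) (s : Finset ℕ) (a : ℕ → ℝ) (ξ x : S2) : ℝ :=
  ∑ l ∈ s, a l * ∑ m ∈ Finset.Icc (-(l : ℤ)) l, sphHarm τ l m ξ * sphHarm τ l m x

theorem continuous_zonalKernel (τ : ℝ) (s : Finset ℕ) (a : ℕ → ℝ) (ξ : S2) :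
    Continuous (zonalKernel τ s a ξ) := by
  unfold zonalKernel
  exact continuous_finsetSum _ fun l _ => continuous_const.mul
    (continuous_finsetSum _ fun m _ => continuous_const.mul (continuous_sphHarm τ l m))

/-- Reproducing property: by orthonormality the squared norm of a kernel is the diagonal value of
the kernel with squared multipliers. -/
theorem integral_zonalKernel_sq {τ : ℝ} (hτ : 0 < τ) (s : Finset ℕ) (a : ℕ → ℝ) (ξ : S2) :
    τ * ∫ x, zonalKernel τ s a ξ x ^ 2 ∂unif = zonalKernel τ s (fun l => a l ^ 2) ξ ξ := by
  set T := s.sigma fun l => Finset.Icc (-(l : ℤ)) l with hT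
  have h1 : ∀ x, zonalKernel τ s a ξ x ^ 2 = ∑ t ∈ T, ∑ t' ∈ T,
      (a t.1 * sphHarm τ t.1 t.2 ξ) * (a t'.1 * sphHarm τ t'.1 t'.2 ξ) *
        (sphHarm τ t.1 t.2 x * sphHarm τ t'.1 t'.2 x) := by
    intro x
    have : zonalKernel τ s a ξ x =
        ∑ t ∈ T, a t.1 * sphHarm τ t.1 t.2 ξ * sphHarm τ t.1 t.2 x := by
      rw [hT, Finset.sum_sigma, zonalKernel]
      refine Finset.sum_congr rfl fun l _ => ?_
      rw [Finset.mul_sum]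
      exact Finset.sum_congr rfl fun m _ => by ring
    rw [this, sq, Finset.sum_mul_sum]
    exact Finset.sum_congr rfl fun t _ => Finset.sum_congr rfl fun t' _ => by ring
  have hint : ∀ t t' : (Σ _ : ℕ, ℤ), Integrable (fun x =>
      (a t.1 * sphHarm τ t.1 t.2 ξ) * (a t'.1 * sphHarm τ t'.1 t'.2 ξ) *
        (sphHarm τ t.1 t.2 x * sphHarm τ t'.1 t'.2 x)) unif := fun t t' =>
    integrable_unif (continuous_const.mul
      ((continuous_sphHarm τ t.1 t.2).mul (continuous_sphHarm τ t'.1 t'.2)))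
  simp only [h1]
  rw [integral_finsetSum _ fun t _ => integrable_finsetSum _ fun t' _ => hint t t', Finset.mul_sum,
    zonalKernel]
  have h2 : ∀ t ∈ T, τ * ∫ x, ∑ t' ∈ T, (a t.1 * sphHarm τ t.1 t.2 ξ) *
      (a t'.1 * sphHarm τ t'.1 t'.2 ξ) * (sphHarm τ t.1 t.2 x * sphHarm τ t'.1 t'.2 x) ∂unif =
      a t.1 ^ 2 * (sphHarm τ t.1 t.2 ξ * sphHarm τ t.1 t.2 ξ) := by
    intro t ht
    rw [integral_finsetSum _ fun t' _ => hint t t', Finset.mul_sum, Finset.sum_eq_single t]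
    · rw [integral_const_mul, mul_left_comm, sphHarm_orthonormal hτ, if_pos ⟨rfl, rfl⟩]
      · ring
      · have := (Finset.mem_sigma.1 ht).2
        rw [Finset.mem_Icc] at this
        omega
    · intro t' _ hne
      rw [integral_const_mul, mul_left_comm, sphHarm_orthonormal hτ, if_neg, mul_zero]
      · rintro ⟨h3, h4⟩
        exact hne (Sigma.ext h3.symm (heq_of_eq h4.symm))
      · have := (Finset.mem_sigma.1 ht).2
        rw [Finset.mem_Icc] at this
        omega
    · exact fun h => absurd ht h
  rw [Finset.sum_congr rfl h2, hT, Finset.sum_sigma]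
  exact Finset.sum_congr rfl fun l _ => by rw [Finset.mul_sum]

theorem exists_mvPolynomial_zonalKernel (τ : ℝ) {s : Finset ℕ} {n : ℕ} (hs : ∀ l ∈ s, l ≤ n)
    (a : ℕ → ℝ) (ξ : S2) :
    ∃ p : MvPolynomial (Fin 3) ℝ, p.totalDegree ≤ n ∧
      ∀ x : S2, p.eval (fun i => (x : EuclideanSpace ℝ (Fin 3)) i) = zonalKernel τ s a ξ x := by
  have h : ∀ (l : ℕ) (m : ℤ), ∃ p : MvPolynomial (Fin 3) ℝ, m.natAbs ≤ l →
      p.totalDegree ≤ l ∧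
        ∀ x : S2, p.eval (fun i => (x : EuclideanSpace ℝ (Fin 3)) i) = sphHarm τ l m x := by
    intro l m
    by_cases hm : m.natAbs ≤ l
    · obtain ⟨p, hp⟩ := exists_mvPolynomial_sphHarm τ hm
      exact ⟨p, fun _ => hp⟩
    · exact ⟨0, fun h => absurd h hm⟩
  choose p hp using h
  refine ⟨∑ l ∈ s, MvPolynomial.C (a l) * ∑ m ∈ Finset.Icc (-(l : ℤ)) l,
    MvPolynomial.C (sphHarm τ l m ξ) * p l m, ?_, fun x => ?_⟩
  · refine MvPolynomial.totalDegree_finsetSum_le fun l hl => ?_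
    refine (MvPolynomial.totalDegree_mul _ _).trans ?_
    rw [MvPolynomial.totalDegree_C, zero_add]
    refine MvPolynomial.totalDegree_finsetSum_le fun m hm => ?_
    refine (MvPolynomial.totalDegree_mul _ _).trans ?_
    rw [MvPolynomial.totalDegree_C, zero_add]
    rw [Finset.mem_Icc] at hm
    exact (hp l m (by omega)).1.trans (hs l hl)
  · rw [map_sum, zonalKernel]
    refine Finset.sum_congr rfl fun l _ => ?_
    rw [map_mul, MvPolynomial.eval_C, map_sum]
    congr 1
    refine Finset.sum_congr rfl fun m hm => ?_
    rw [Finset.mem_Icc] at hm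
    rw [map_mul, MvPolynomial.eval_C, (hp l m (by omega)).2]

theorem IsWindow.sq_le_one {B : ℝ} {b : ℝ → ℝ} (hb : IsWindow B b) (j : ℕ) {l : ℕ} (hl : 1 ≤ l) :
    b (l / B ^ j) ^ 2 ≤ 1 :=
  le_hasSum (hb.partition_of_unity l hl) j fun _ _ => sq_nonneg _

variable {τ B : ℝ} {b : ℝ → ℝ}

theorem needlet_eq (Q : Cubature τ B) (j : ℕ) (k : Fin (Q.K j)) (x : S2) :
    needlet b Q j k x = √(Q.wt j k) * zonalKernel τ
      (Finset.Icc ⌈B ^ ((j : ℤ) - 1)⌉₊ ⌊B ^ (j + 1)⌋₊) (fun l => b (l / B ^ j)) (Q.pt j k) x := rfl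

theorem continuous_needlet (Q : Cubature τ B) (j : ℕ) (k : Fin (Q.K j)) :
    Continuous (needlet b Q j k) :=
  continuous_const.mul (continuous_zonalKernel _ _ _ _)

/-- The weights of the cubature formula compensate the size of the kernels on the diagonal: the
cubature formula is exact for the square of the kernel with multipliers `b²`, and the term of the
point `ξ` alone is at least `wt * K(ξ, ξ)²`, while the integral of the square is at most
`K(ξ, ξ)`. -/
theorem wt_mul_zonalKernel_le_one (hτ : 0 < τ) (hB : 1 < B) (hb : IsWindow B b)
    (Q : Cubature τ B) (j : ℕ) (k : Fin (Q.K j)) :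
    Q.wt j k * zonalKernel τ (Finset.Icc ⌈B ^ ((j : ℤ) - 1)⌉₊ ⌊B ^ (j + 1)⌋₊)
      (fun l => b (l / B ^ j) ^ 2) (Q.pt j k) (Q.pt j k) ≤ 1 := by
  set s := Finset.Icc ⌈B ^ ((j : ℤ) - 1)⌉₊ ⌊B ^ (j + 1)⌋₊ with hs
  set a : ℕ → ℝ := fun l => b (l / B ^ j) ^ 2 with ha
  set ξ := Q.pt j k
  set A := zonalKernel τ s a ξ ξ with hA
  obtain ⟨p, hpd, hp⟩ := exists_mvPolynomial_zonalKernel τ (s := s) (n := ⌊B ^ (j + 1)⌋₊)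
    (fun l hl => (Finset.mem_Icc.1 hl).2) a ξ
  have hex := Q.exact j (p ^ 2) ((MvPolynomial.totalDegree_pow _ _).trans (by omega))
  simp only [map_pow, hp] at hex
  rw [integral_zonalKernel_sq hτ] at hex
  have h1 : Q.wt j k * A ^ 2 ≤ ∑ i, Q.wt j i * zonalKernel τ s a ξ (Q.pt j i) ^ 2 :=
    Finset.single_le_sum (f := fun i => Q.wt j i * zonalKernel τ s a ξ (Q.pt j i) ^ 2)
      (fun i _ => mul_nonneg (Q.wt_pos j i).le (sq_nonneg _)) (Finset.mem_univ k)
  have hY : ∀ l : ℕ, 0 ≤ ∑ m ∈ Finset.Icc (-(l : ℤ)) l, sphHarm τ l m ξ * sphHarm τ l m ξ :=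
    fun l => Finset.sum_nonneg fun m _ => mul_self_nonneg _
  have hA0 : 0 ≤ A := Finset.sum_nonneg fun l _ => mul_nonneg (sq_nonneg _) (hY l)
  have h2 : zonalKernel τ s (fun l => a l ^ 2) ξ ξ ≤ A := by
    refine Finset.sum_le_sum fun l hl => mul_le_mul_of_nonneg_right ?_ (hY l)
    -- The degree zero, where the partition of unity says nothing, does not occur in the sum.
    have hl1 : 1 ≤ l := by
      refine le_trans ?_ (Finset.mem_Icc.1 hl).1
      exact Nat.ceil_pos.2 (by positivity)
    exact pow_le_of_le_one (sq_nonneg _) (hb.sq_le_one j hl1) two_ne_zero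
  by_contra! hcon
  have hApos : 0 < A := by
    rcases hA0.eq_or_lt with h | h
    · rw [← h, mul_zero] at hcon; linarith
    · exact h
  nlinarith

theorem integral_needlet_sq_le (hτ : 0 < τ) (hB : 1 < B) (hb : IsWindow B b)
    (Q : Cubature τ B) (j : ℕ) (k : Fin (Q.K j)) :
    ∫ x, needlet b Q j k x ^ 2 ∂unif ≤ τ⁻¹ := by
  have h := wt_mul_zonalKernel_le_one hτ hB hb Q j k
  rw [← integral_zonalKernel_sq hτ] at h
  simp only [needlet_eq, mul_pow, Real.sq_sqrt (Q.wt_pos j k).le]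
  rw [integral_const_mul, ← one_div, le_div_iff₀ hτ]
  linarith

theorem memLp_needlet (Q : Cubature τ B) (j : ℕ) (k : Fin (Q.K j)) :
    MemLp (needlet b Q j k) 2 unif :=
  (memLp_two_iff_integrable_sq (continuous_needlet Q j k).aestronglyMeasurable).2
    (integrable_unif ((continuous_needlet Q j k).pow 2))

theorem needletNorm_sq (Q : Cubature τ B) (j : ℕ) (k : Fin (Q.K j)) :
    needletNorm b Q j k ^ 2 = ∫ x, needlet b Q j k x ^ 2 ∂unif := by
  rw [needletNorm, (memLp_needlet Q j k).eLpNorm_eq_integral_rpow_norm two_ne_zero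
    ENNReal.ofNat_ne_top, ENNReal.toReal_ofReal (by positivity)]
  have h0 : 0 ≤ ∫ x, needlet b Q j k x ^ 2 ∂unif := integral_nonneg fun _ => sq_nonneg _
  simp only [ENNReal.toReal_ofNat, Real.rpow_ofNat, Real.norm_eq_abs, sq_abs]
  rw [← Real.rpow_natCast, ← Real.rpow_mul h0]
  norm_num

/-! ### Moments in the regression model -/

theorem measurePreserving_prodProdProdComm {α α' β β' : Type*} [MeasurableSpace α]
    [MeasurableSpace α'] [MeasurableSpace β] [MeasurableSpace β'] (μ : Measure α) (μ' : Measure α')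
    (ν : Measure β) (ν' : Measure β') [SFinite μ] [SFinite μ'] [SFinite ν] [SFinite ν'] :
    MeasurePreserving (Equiv.prodProdProdComm α α' β β') ((μ.prod μ').prod (ν.prod ν'))
      ((μ.prod ν).prod (μ'.prod ν')) := by
  have h1 := measurePreserving_prodAssoc μ μ' (ν.prod ν')
  have h2 := (measurePreserving_prodAssoc μ' ν ν').symm
  have h3 := (Measure.measurePreserving_swap (μ := μ') (ν := ν)).prod (MeasurePreserving.id ν')
  have h4 := measurePreserving_prodAssoc ν μ' ν'
  have h5 := (MeasurePreserving.id μ).prod (h4.comp (h3.comp h2))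
  have h6 := (measurePreserving_prodAssoc μ ν (μ'.prod ν')).symm
  exact h6.comp (h5.comp h1)

/-- If the variables within each of two pairs `(X, X')` and `(E, E')` are independent and the pairs
are independent of each other, then `(X, E)` and `(X', E')` are independent. -/
theorem indepFun_prodMk_prodMk {Ω α β : Type*} [MeasurableSpace Ω] [MeasurableSpace α]
    [MeasurableSpace β] {P : Measure Ω} [IsProbabilityMeasure P] {X X' : Ω → α} {E E' : Ω → β}
    (hX : AEMeasurable X P) (hX' : AEMeasurable X' P) (hE : AEMeasurable E P)
    (hE' : AEMeasurable E' P) (h1 : IndepFun X X' P) (h2 : IndepFun E E' P)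
    (h3 : IndepFun (fun w => (X w, X' w)) (fun w => (E w, E' w)) P) :
    IndepFun (fun w => (X w, E w)) (fun w => (X' w, E' w)) P := by
  have hXE : IndepFun X E P := h3.comp measurable_fst measurable_fst
  have hXE' : IndepFun X' E' P := h3.comp measurable_snd measurable_snd
  rw [indepFun_iff_map_prod_eq_prod_map_map (hX.prodMk hE) (hX'.prodMk hE'),
    (indepFun_iff_map_prod_eq_prod_map_map hX hE).1 hXE,
    (indepFun_iff_map_prod_eq_prod_map_map hX' hE').1 hXE']
  rw [indepFun_iff_map_prod_eq_prod_map_map (hX.prodMk hX') (hE.prodMk hE'),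
    (indepFun_iff_map_prod_eq_prod_map_map hX hX').1 h1,
    (indepFun_iff_map_prod_eq_prod_map_map hE hE').1 h2] at h3
  have h4 := measurePreserving_prodProdProdComm (P.map X) (P.map X') (P.map E) (P.map E')
  rw [← h4.map_eq, ← h3, AEMeasurable.map_map_of_aemeasurable h4.measurable.aemeasurable
    ((hX.prodMk hX').prodMk (hE.prodMk hE'))]
  rfl

section Model

variable {Ω : Type*} [MeasurableSpace Ω] {P : Measure Ω} {N : ℕ}
  {g σ : S2 → ℝ} {G S γ₃ γ₄ : ℝ} {X : Fin N → Ω → S2} {ε : Fin N → Ω → ℝ}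

theorem IsModel.aemeasurable_noise (M : IsModel P g σ G S γ₃ γ₄ X ε) (i : Fin N) :
    AEMeasurable (ε i) P := (M.memLp_noise i).aestronglyMeasurable.aemeasurable

theorem IsModel.bound_nonneg (M : IsModel P g σ G S γ₃ γ₄ X ε) (x : S2) : 0 ≤ G ∧ 0 ≤ S :=
  ⟨(abs_nonneg _).trans (M.abs_g_le x), (M.scale_nonneg x).trans (M.scale_le x)⟩

variable {ψ : S2 → ℝ}

theorem IsModel.measurable_weight (M : IsModel P g σ G S γ₃ γ₄ X ε) (hψ : Continuous ψ)
    (p q r : ℕ) : Measurable fun x => g x ^ p * σ x ^ q * ψ x ^ r :=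
  ((M.measurable_g.pow_const p).mul (M.measurable_scale.pow_const q)).mul
    (hψ.measurable.pow_const r)

theorem IsModel.abs_weight_le (M : IsModel P g σ G S γ₃ γ₄ X ε) (p q r : ℕ) (x : S2) :
    |g x ^ p * σ x ^ q * ψ x ^ r| ≤ G ^ p * S ^ q * |ψ x| ^ r := by
  have hS := M.scale_nonneg x
  have hG := M.bound_nonneg x
  rw [abs_mul, abs_mul, abs_pow, abs_pow, abs_pow, abs_of_nonneg hS]
  gcongr
  · exact pow_nonneg hG.1 _
  · exact M.abs_g_le x
  · exact M.scale_le x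

theorem IsModel.integrable_weight (M : IsModel P g σ G S γ₃ γ₄ X ε) (hψ : Continuous ψ)
    (p q r : ℕ) : Integrable (fun x => g x ^ p * σ x ^ q * ψ x ^ r) unif :=
  (integrable_unif ((hψ.abs.pow r).const_mul (G ^ p * S ^ q))).mono'
    (M.measurable_weight hψ p q r).aestronglyMeasurable
    (.of_forall fun x => M.abs_weight_le p q r x)

theorem IsModel.abs_integral_weight_le (M : IsModel P g σ G S γ₃ γ₄ X ε) (hψ : Continuous ψ)
    (p q : ℕ) :
    |∫ x, g x ^ p * σ x ^ q * ψ x ^ 2 ∂unif| ≤ G ^ p * S ^ q * ∫ x, ψ x ^ 2 ∂unif := by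
  rw [← integral_const_mul, ← Real.norm_eq_abs]
  refine norm_integral_le_of_norm_le (integrable_unif (continuous_const.mul (hψ.pow 2)))
    (.of_forall fun x => ?_)
  have := M.abs_weight_le (ψ := ψ) p q 2 x
  rwa [sq_abs] at this

theorem IsModel.integral_weight_mul_noise_pow (M : IsModel P g σ G S γ₃ γ₄ X ε)
    (hψ : Continuous ψ) (p q r k : ℕ) (i : Fin N) :
    ∫ w, g (X i w) ^ p * σ (X i w) ^ q * ψ (X i w) ^ r * ε i w ^ k ∂P =
      (∫ x, g x ^ p * σ x ^ q * ψ x ^ r ∂unif) * ∫ w, ε i w ^ k ∂P := by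
  have hind : IndepFun (X i) (ε i) P :=
    M.indep_design_noise.comp (measurable_pi_apply i) (measurable_pi_apply i)
  have hm := M.measurable_weight hψ p q r
  rw [hind.integral_fun_comp_mul_comp (f := fun x => g x ^ p * σ x ^ q * ψ x ^ r)
    (g := fun e => e ^ k) (M.law_design i).aemeasurable (M.aemeasurable_noise i)
    hm.aestronglyMeasurable (measurable_id.pow_const k).aestronglyMeasurable,
    ← (M.law_design i).integral_comp hm.aestronglyMeasurable]
  rfl

theorem IsModel.aestronglyMeasurable_summand (M : IsModel P g σ G S γ₃ γ₄ X ε)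
    (hψ : Continuous ψ) (i : Fin N) :
    AEStronglyMeasurable (fun w => obs g σ X ε i w ^ 2 * ψ (X i w)) P := by
  have hXi := (M.law_design i).aemeasurable
  exact (((M.measurable_g.comp_aemeasurable hXi).add
    ((M.measurable_scale.comp_aemeasurable hXi).mul (M.aemeasurable_noise i))).pow_const 2 |>.mul
      (hψ.measurable.comp_aemeasurable hXi)).aestronglyMeasurable

variable [IsProbabilityMeasure P]

theorem IsModel.integrable_noise_pow (M : IsModel P g σ G S γ₃ γ₄ X ε) (i : Fin N) {k : ℕ}
    (hk : k ≤ 4) : Integrable (fun w => ε i w ^ k) P := by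
  have h : MemLp (ε i) k P := (M.memLp_noise i).mono_exponent (by exact_mod_cast hk)
  refine (integrable_norm_iff ((M.aemeasurable_noise i).pow_const k).aestronglyMeasurable).1 ?_
  simpa only [norm_pow] using h.integrable_norm_pow'

theorem IsModel.indepFun_pair (M : IsModel P g σ G S γ₃ γ₄ X ε) {i i' : Fin N} (h : i ≠ i') :
    IndepFun (fun w => (X i w, ε i w)) (fun w => (X i' w, ε i' w)) P :=
  indepFun_prodMk_prodMk (M.law_design i).aemeasurable (M.law_design i').aemeasurable
    (M.aemeasurable_noise i) (M.aemeasurable_noise i') (M.indep_design.indepFun h)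
    (M.indep_noise.indepFun h)
    (M.indep_design_noise.comp ((measurable_pi_apply i).prodMk (measurable_pi_apply i'))
      ((measurable_pi_apply i).prodMk (measurable_pi_apply i')))

theorem IsModel.integrable_weight_mul_noise_pow (M : IsModel P g σ G S γ₃ γ₄ X ε)
    (hψ : Continuous ψ) (p q r : ℕ) {k : ℕ} (hk : k ≤ 4) (i : Fin N) :
    Integrable (fun w => g (X i w) ^ p * σ (X i w) ^ q * ψ (X i w) ^ r * ε i w ^ k) P := by
  have hXi := (M.law_design i).aemeasurable
  have h1 : Integrable (fun w => g (X i w) ^ p * σ (X i w) ^ q * ψ (X i w) ^ r) P := by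
    have := M.integrable_weight hψ p q r
    rw [← (M.law_design i).map_eq] at this
    exact this.comp_aemeasurable hXi
  have hind : IndepFun (X i) (ε i) P :=
    M.indep_design_noise.comp (measurable_pi_apply i) (measurable_pi_apply i)
  exact (hind.comp (M.measurable_weight hψ p q r) (measurable_id.pow_const k)).integrable_mul h1
    (M.integrable_noise_pow i hk)

theorem IsModel.integral_summand (M : IsModel P g σ G S γ₃ γ₄ X ε) (hψ : Continuous ψ)
    (i : Fin N) : ∫ w, obs g σ X ε i w ^ 2 * ψ (X i w) ∂P =
      (∫ x, g x ^ 2 * ψ x ∂unif) + ∫ x, σ x ^ 2 * ψ x ∂unif := by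
  have I := fun (p q k : ℕ) (hk : k ≤ 4) => M.integrable_weight_mul_noise_pow hψ p q 1 hk i
  have hexp : ∀ w, obs g σ X ε i w ^ 2 * ψ (X i w) =
      (g (X i w) ^ 2 * σ (X i w) ^ 0 * ψ (X i w) ^ 1 * ε i w ^ 0 +
        2 * (g (X i w) ^ 1 * σ (X i w) ^ 1 * ψ (X i w) ^ 1 * ε i w ^ 1)) +
        g (X i w) ^ 0 * σ (X i w) ^ 2 * ψ (X i w) ^ 1 * ε i w ^ 2 := by
    intro w; unfold obs; ring
  simp only [hexp]
  rw [integral_add, integral_add, integral_const_mul, M.integral_weight_mul_noise_pow hψ,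
    M.integral_weight_mul_noise_pow hψ, M.integral_weight_mul_noise_pow hψ, M.variance_noise i]
  · simp [M.mean_noise i]
  · exact I 2 0 0 (by norm_num)
  · exact (I 1 1 1 (by norm_num)).const_mul 2
  · exact (I 2 0 0 (by norm_num)).add ((I 1 1 1 (by norm_num)).const_mul 2)
  · exact I 0 2 2 (by norm_num)

theorem obs_pow_four_mul_sq {Ω : Type*} (g σ : S2 → ℝ) (X : Fin N → Ω → S2)
    (ε : Fin N → Ω → ℝ) (ψ : S2 → ℝ) (i : Fin N) (w : Ω) : (obs g σ X ε i w ^ 2 * ψ (X i w)) ^ 2 =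
      g (X i w) ^ 4 * σ (X i w) ^ 0 * ψ (X i w) ^ 2 * ε i w ^ 0 +
        4 * (g (X i w) ^ 3 * σ (X i w) ^ 1 * ψ (X i w) ^ 2 * ε i w ^ 1) +
        6 * (g (X i w) ^ 2 * σ (X i w) ^ 2 * ψ (X i w) ^ 2 * ε i w ^ 2) +
        4 * (g (X i w) ^ 1 * σ (X i w) ^ 3 * ψ (X i w) ^ 2 * ε i w ^ 3) +
        g (X i w) ^ 0 * σ (X i w) ^ 4 * ψ (X i w) ^ 2 * ε i w ^ 4 := by
  unfold obs; ring

theorem IsModel.memLp_summand (M : IsModel P g σ G S γ₃ γ₄ X ε) (hψ : Continuous ψ)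
    (i : Fin N) : MemLp (fun w => obs g σ X ε i w ^ 2 * ψ (X i w)) 2 P := by
  refine (memLp_two_iff_integrable_sq (M.aestronglyMeasurable_summand hψ i)).2 ?_
  have I := fun (p q k : ℕ) (hk : k ≤ 4) => M.integrable_weight_mul_noise_pow hψ p q 2 hk i
  simp only [obs_pow_four_mul_sq]
  exact ((((I 4 0 0 (by norm_num)).add ((I 3 1 1 (by norm_num)).const_mul 4)).add
    ((I 2 2 2 (by norm_num)).const_mul 6)).add ((I 1 3 3 (by norm_num)).const_mul 4)).add
    (I 0 4 4 le_rfl)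

/-- The fourth moment of an observation, given the design, is
`g⁴ + 6 g² σ² + 4 γ₃ g σ³ + γ₄ σ⁴`. -/
theorem IsModel.variance_summand_le (M : IsModel P g σ G S γ₃ γ₄ X ε) (hψ : Continuous ψ)
    (i : Fin N) : variance (fun w => obs g σ X ε i w ^ 2 * ψ (X i w)) P ≤
      (S ^ 4 * γ₄ + 4 * (G * S ^ 3 * |γ₃|) + 6 * (G ^ 2 * S ^ 2) + G ^ 4) *
        ∫ x, ψ x ^ 2 ∂unif := by
  refine (variance_le_expectation_sq (M.aestronglyMeasurable_summand hψ i)).trans ?_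
  have I := fun (p q k : ℕ) (hk : k ≤ 4) => M.integrable_weight_mul_noise_pow hψ p q 2 hk i
  have I0 := I 4 0 0 (by norm_num)
  have I1 := (I 3 1 1 (by norm_num)).const_mul 4
  have I2 := (I 2 2 2 (by norm_num)).const_mul 6
  have I3 := (I 1 3 3 (by norm_num)).const_mul 4
  simp only [Pi.pow_apply, obs_pow_four_mul_sq]
  rw [integral_add, integral_add, integral_add, integral_add]
  rotate_left
  · exact I0
  · exact I1
  · exact I0.add I1
  · exact I2
  · exact (I0.add I1).add I2
  · exact I3
  · exact ((I0.add I1).add I2).add I3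
  · exact I 0 4 4 le_rfl
  simp only [integral_const_mul, M.integral_weight_mul_noise_pow hψ]
  rw [M.variance_noise i, M.third_moment_noise i, M.fourth_moment_noise i]
  have h1 : ∫ w, ε i w ^ 1 ∂P = 0 := by simpa using M.mean_noise i
  have h0 : ∫ w, ε i w ^ 0 ∂P = 1 := by simp
  have hγ₄ : 0 ≤ γ₄ := by
    rw [← M.fourth_moment_noise i]
    exact integral_nonneg fun w => by positivity
  have B := fun p q => M.abs_integral_weight_le hψ p q
  rw [h0, h1]
  have B0 := (le_abs_self _).trans (B 4 0)
  have B2 := (le_abs_self _).trans (B 2 2)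
  have B4 := mul_le_mul_of_nonneg_right ((le_abs_self _).trans (B 0 4)) hγ₄
  have B3 : (∫ x, g x ^ 1 * σ x ^ 3 * ψ x ^ 2 ∂unif) * γ₃ ≤
      G ^ 1 * S ^ 3 * (∫ x, ψ x ^ 2 ∂unif) * |γ₃| := by
    refine (le_abs_self _).trans ?_
    rw [abs_mul]
    exact mul_le_mul_of_nonneg_right (B 1 3) (abs_nonneg _)
  simp only [pow_zero, pow_one, mul_one, one_mul] at B0 B2 B3 B4 ⊢
  linarith

/-- Expand the nonnegative second moment of `ε² - γ₃ ε`. -/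
theorem IsModel.sq_third_moment_le (M : IsModel P g σ G S γ₃ γ₄ X ε) (i : Fin N) :
    γ₃ ^ 2 ≤ γ₄ := by
  have h : 0 ≤ ∫ w, (ε i w ^ 2 - γ₃ * ε i w) ^ 2 ∂P := integral_nonneg fun _ => sq_nonneg _
  have I := fun k (hk : k ≤ 4) => M.integrable_noise_pow i hk
  have hexp : ∀ w, (ε i w ^ 2 - γ₃ * ε i w) ^ 2 =
      ε i w ^ 4 + -2 * γ₃ * ε i w ^ 3 + γ₃ ^ 2 * ε i w ^ 2 := fun w => by ring
  simp only [hexp] at h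
  have I4 := I 4 le_rfl
  have I3 := (I 3 (by norm_num)).const_mul (-2 * γ₃)
  rw [integral_add (by exact I4.add I3) ((I 2 (by norm_num)).const_mul _), integral_add I4 I3,
    integral_const_mul, integral_const_mul, M.variance_noise i, M.third_moment_noise i,
    M.fourth_moment_noise i] at h
  linarith

end Model

/-- With `u = G S` and `t = S² |γ₃|`, so that `t² ≤ S⁴ γ₄`, this reduces to the positive
semidefiniteness of the form `15 t² - 20 u t + 10 u²`. -/
theorem moment_bound_le {G S γ₃ γ₄ : ℝ} (hG : 0 ≤ G) (hS : 0 ≤ S) (h : γ₃ ^ 2 ≤ γ₄) :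
    S ^ 4 * γ₄ + 4 * (G * S ^ 3 * |γ₃|) + 6 * (G ^ 2 * S ^ 2) + G ^ 4 ≤
      16 * (S ^ 4 * γ₄ + G * S ^ 3 * γ₃ + G ^ 2 * S ^ 2 + G ^ 4) := by
  have h1 : (S ^ 2 * |γ₃|) ^ 2 ≤ S ^ 4 * γ₄ := by
    rw [mul_pow, sq_abs, ← pow_mul]
    exact mul_le_mul_of_nonneg_left h (by positivity)
  have h2 : -(G * S * (S ^ 2 * |γ₃|)) ≤ G * S ^ 3 * γ₃ := by
    have := mul_le_mul_of_nonneg_left (neg_abs_le γ₃) (show 0 ≤ G * S ^ 3 by positivity)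
    linarith
  nlinarith [sq_nonneg (G * S - S ^ 2 * |γ₃|), sq_nonneg (G * S), sq_nonneg (S ^ 2 * |γ₃|),
    sq_nonneg (G ^ 2)]

/-! ### The empirical coefficients -/

section Empirical

variable {Ω : Type*} [MeasurableSpace Ω] {P : Measure Ω} {N : ℕ}
  {g σ : S2 → ℝ} {G S γ₃ γ₄ : ℝ} {X : Fin N → Ω → S2} {ε : Fin N → Ω → ℝ} {τ B : ℝ} {b : ℝ → ℝ}

theorem IsModel.coeff_add (M : IsModel P g σ G S γ₃ γ₄ X ε) (Q : Cubature τ B) (j : ℕ)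
    (k : Fin (Q.K j)) : coeff b Q (fun x => g x ^ 2 + σ x ^ 2) j k =
      coeff b Q (fun x => σ x ^ 2) j k + coeff b Q (fun x => g x ^ 2) j k := by
  have hψ := continuous_needlet (b := b) Q j k
  have h1 := M.integrable_weight hψ 2 0 1
  have h2 := M.integrable_weight hψ 0 2 1
  simp only [pow_zero, pow_one, mul_one, one_mul] at h1 h2
  unfold coeff
  rw [← integral_add h2 h1]
  congr 1
  ext x
  ring

variable [IsProbabilityMeasure P]

theorem IsModel.memLp_empCoeff (M : IsModel P g σ G S γ₃ γ₄ X ε) (Q : Cubature τ B) (j : ℕ)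
    (k : Fin (Q.K j)) : MemLp (empCoeff b Q X (obs g σ X ε) j k) 2 P :=
  (memLp_finsetSum _ fun i _ => M.memLp_summand (continuous_needlet Q j k) i).const_mul _

theorem IsModel.integral_empCoeff (M : IsModel P g σ G S γ₃ γ₄ X ε) (hN : 0 < N)
    (Q : Cubature τ B) (j : ℕ) (k : Fin (Q.K j)) :
    ∫ w, empCoeff b Q X (obs g σ X ε) j k w ∂P =
      coeff b Q (fun x => σ x ^ 2) j k + coeff b Q (fun x => g x ^ 2) j k := by
  have hψ := continuous_needlet (b := b) Q j k
  unfold empCoeff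
  rw [integral_const_mul,
    integral_finsetSum _ fun i _ => (M.memLp_summand hψ i).integrable one_le_two]
  simp only [M.integral_summand hψ]
  rw [Finset.sum_const, Finset.card_univ, Fintype.card_fin, nsmul_eq_mul, ← mul_assoc,
    inv_mul_cancel₀ (by positivity), one_mul, add_comm]
  rfl

theorem IsModel.variance_empCoeff_le (M : IsModel P g σ G S γ₃ γ₄ X ε) (hN : 0 < N)
    (Q : Cubature τ B) (j : ℕ) (k : Fin (Q.K j)) :
    variance (empCoeff b Q X (obs g σ X ε) j k) P ≤
      (S ^ 4 * γ₄ + 4 * (G * S ^ 3 * |γ₃|) + 6 * (G ^ 2 * S ^ 2) + G ^ 4) *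
        needletNorm b Q j k ^ 2 / N := by
  have hψ := continuous_needlet (b := b) Q j k
  have hsum : empCoeff b Q X (obs g σ X ε) j k = fun w => (N : ℝ)⁻¹ *
      (∑ i, fun w => obs g σ X ε i w ^ 2 * needlet b Q j k (X i w)) w := by
    ext w
    rw [Finset.sum_apply]
    rfl
  have hF : Measurable fun p : S2 × ℝ =>
      (g p.1 + σ p.1 * p.2) ^ 2 * needlet b Q j k p.1 :=
    (((M.measurable_g.comp measurable_fst).add
      ((M.measurable_scale.comp measurable_fst).mul measurable_snd)).pow_const 2).mul
        (hψ.measurable.comp measurable_fst)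
  rw [hsum, variance_const_mul, IndepFun.variance_sum (fun i _ => M.memLp_summand hψ i)
    (fun i _ i' _ h => (M.indepFun_pair h).comp hF hF)]
  have h1 := Finset.sum_le_sum fun i (_ : i ∈ Finset.univ) => M.variance_summand_le hψ i
  rw [Finset.sum_const, Finset.card_univ, Fintype.card_fin, nsmul_eq_mul,
    ← needletNorm_sq] at h1
  have hN' : (0 : ℝ) < N := by exact_mod_cast hN
  refine (mul_le_mul_of_nonneg_left h1 (sq_nonneg _)).trans_eq ?_
  field_simp

end Empirical

theorem eLpNorm_needlet_eq {τ B : ℝ} {b : ℝ → ℝ} (Q : Cubature τ B) (j : ℕ) (k : Fin (Q.K j)) :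
    eLpNorm (needlet b Q j k) 2 unif = ENNReal.ofReal (needletNorm b Q j k) :=
  (ENNReal.ofReal_toReal (memLp_needlet Q j k).eLpNorm_ne_top).symm

end SphNeedlet

end

theorem mainTheorem6 (τ B : ℝ) (hτ : 0 < τ) (hB : 1 < B) (b : ℝ → ℝ)
    (hb : SphNeedlet.IsWindow B b) (Q : SphNeedlet.Cubature τ B) :
    ∃ Cψ : ℝ, 0 < Cψ ∧
      (∀ (j : ℕ) (k : Fin (Q.K j)),
        eLpNorm (SphNeedlet.needlet b Q j k) 2 SphNeedlet.unif ≤ ENNReal.ofReal Cψ) ∧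
      ∀ {Ω : Type*} [MeasurableSpace Ω] (P : Measure Ω) [IsProbabilityMeasure P] (N : ℕ)
        (_ : 0 < N) (g σ : SphNeedlet.S2 → ℝ) (G S γ₃ γ₄ : ℝ)
        (X : Fin N → Ω → SphNeedlet.S2) (ε : Fin N → Ω → ℝ)
        (_ : SphNeedlet.IsModel P g σ G S γ₃ γ₄ X ε) (j : ℕ) (k : Fin (Q.K j)),
        MemLp (SphNeedlet.empCoeff b Q X (SphNeedlet.obs g σ X ε) j k) 2 P ∧
        ∫ w, SphNeedlet.empCoeff b Q X (SphNeedlet.obs g σ X ε) j k w ∂P =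
          SphNeedlet.coeff b Q (fun x => g x ^ 2 + σ x ^ 2) j k ∧
        SphNeedlet.coeff b Q (fun x => g x ^ 2 + σ x ^ 2) j k =
          SphNeedlet.coeff b Q (fun x => σ x ^ 2) j k +
            SphNeedlet.coeff b Q (fun x => g x ^ 2) j k ∧
        variance (SphNeedlet.empCoeff b Q X (SphNeedlet.obs g σ X ε) j k) P ≤
          (S ^ 4 * γ₄ + G * S ^ 3 * γ₃ + G ^ 2 * S ^ 2 + G ^ 4) * Cψ ^ 2 / N ∧
        variance (SphNeedlet.empCoeff b Q X (SphNeedlet.obs g σ X ε) j k) P ≤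
          (S ^ 4 * γ₄ + 4 * (G * S ^ 3 * |γ₃|) + 6 * (G ^ 2 * S ^ 2) + G ^ 4) *
            SphNeedlet.needletNorm b Q j k ^ 2 / N := by
  have hsq : (4 / √τ) ^ 2 = 16 * τ⁻¹ := by
    rw [div_pow, Real.sq_sqrt hτ.le]
    ring
  have hnorm : ∀ (j : ℕ) (k : Fin (Q.K j)), SphNeedlet.needletNorm b Q j k ^ 2 ≤ τ⁻¹ :=
    fun j k => (SphNeedlet.needletNorm_sq Q j k).trans_le
      (SphNeedlet.integral_needlet_sq_le hτ hB hb Q j k)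
  -- The norms are at most `1 / √τ`; the factor `4` absorbs the numerical constants `4` and `6`
  -- of the fourth moment.
  refine ⟨4 / √τ, by positivity, fun j k => ?_, ?_⟩
  · rw [SphNeedlet.eLpNorm_needlet_eq]
    refine ENNReal.ofReal_le_ofReal (abs_le_of_sq_le_sq' ?_ (by positivity)).2
    rw [hsq]
    have := inv_pos.2 hτ
    linarith [hnorm j k]
  · intro Ω _ P _ N hN g σ G S γ₃ γ₄ X ε M j k
    have hvar := M.variance_empCoeff_le (b := b) hN Q j k
    refine ⟨M.memLp_empCoeff Q j k, (M.integral_empCoeff hN Q j k).trans (M.coeff_add Q j k).symm,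
      M.coeff_add Q j k, hvar.trans ?_, hvar⟩
    obtain ⟨hG, hS⟩ := M.bound_nonneg (Q.pt j k)
    have hγ := M.sq_third_moment_le ⟨0, hN⟩
    have hγ₄ : 0 ≤ γ₄ := (sq_nonneg _).trans hγ
    refine div_le_div_of_nonneg_right ?_ (Nat.cast_nonneg N)
    rw [hsq]
    calc _ ≤ (S ^ 4 * γ₄ + 4 * (G * S ^ 3 * |γ₃|) + 6 * (G ^ 2 * S ^ 2) + G ^ 4) * τ⁻¹ :=
          mul_le_mul_of_nonneg_left (hnorm j k) (by positivity)
      _ ≤ 16 * (S ^ 4 * γ₄ + G * S ^ 3 * γ₃ + G ^ 2 * S ^ 2 + G ^ 4) * τ⁻¹ :=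
          mul_le_mul_of_nonneg_right (SphNeedlet.moment_bound_le hG hS hγ) (inv_pos.2 hτ).le
      _ = _ := by ring
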